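/- **Definitions.** A partial linear space is a non-empty set $P$ of points with a family of proper subsets (lines) such that every line has at least two points, every point is on a line, and two distinct points lie on at most one common line. Points $p,q$ are collinear, $p\perp q$, if some line contains both; $X\perp Y$ means that all points of $X$ are collinear with all points of $Y$. A subspace is a set of points containing the line through any two of its distinct collinear points; it is singular if any two of its points are collinear. $\langle X\rangle$ is the intersection of all subspaces containing $X$, and $X$ is independent if $\langle X\rangle\neq\langle Y\rangle$ for every proper subset $Y\subset X$. A base of a subspace $S$ is an independent subset of $S$ spanning $S$; $\dim S$ is the smallest $d$ such that $S$ has a base of $d+1$ points (so $\dim\emptyset=-1$). A polar space is a partial linear space in which every line has at least three points, no point is collinear with all other points, each point is collinear with exactly one or with all points of any line, and every chain of singular subspaces is finite; it has rank $n$ if all its maximal singular subspaces have dimension $n-1$. Let $\Pi$ be a polar space of rank $n$, and let $\mathcal G_j(\Pi)$ be the set of its $j$-dimensional singular subspaces. For singular subspaces $S\subset U$ put $[S\rangle_j=\{X\in\mathcal G_j(\Pi): S\subset X\}$ and $[S,U]_j=\{X\in\mathcal G_j(\Pi): S\subset X\subset U\}$. For $0\le j\le n-2$, the space $\mathfrak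 G_j(\Pi)$ has point set $\mathcal G_j(\Pi)$ and lines $[S,U]_j$ with $S\in\mathcal G_{j-1}(\Pi)$, $U\in\mathcal G_{j+1}(\Pi)$, $S\subset U$; the graph $\Gamma_j(\Pi)$ on $\mathcal G_j(\Pi)$ joins $S$ and $U$ if $\dim(S\cap U)=j-1$ and $S\perp U$. For $\mathcal X\subset\mathcal G_j(\Pi)$, $\Gamma(\mathcal X)$ is the subgraph of $\Gamma_j(\Pi)$ induced on $\mathcal X$. If $\dim N=j-1$, then $[N\rangle_j$, with the lines of $\mathfrak G_j(\Pi)$ contained in it, is a polar space. An $l$-frame of a polar space is a set of $2l$ distinct points each of which is non-collinear with exactly one point of the set. A subset of $\{\pm1,\dots,\pm l\}$ is singular if it does not contain $j$ and $-j$ simultaneously for any $j$. For $0\le m\le l-2$, the vertices of the polar Johnson graph $PJ(l,m)$ are the singular subsets with $m+1$ elements, two of them being adjacent if their intersection has $m$ elements and their union is singular. **Theorem.** Let $\Pi$ be a polar space of rank $n$, and let $k,l,m$ be natural numbers with $$0<m\le k,\qquad l\le n,\qquad 3\le l-m\le n-k.$$ Let $\mathcal X\subset\mathcal G_k(\Pi)$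 be such that $\Gamma(\mathcal X)$ is isomorphic to $PJ(l,m)$ and every maximal clique of $\Gamma(\mathcal X)$ is an independent subset of $\mathfrak G_k(\Pi)$. Suppose that one of the following conditions holds: 1. $m+2>n-k$; 2. $l-m\ge 4$ and $\mathcal X$ is not contained in any big star $[S\rangle_k$, $S\in\mathcal G_{k-1}(\Pi)$. Then there exists a $(k-m-1)$-dimensional singular subspace $N$ of $\Pi$ such that $\mathcal X\subset[N\rangle_k$, and there is an $l$-frame $\mathcal B$ of the polar space $[N\rangle_{k-m}$ such that every $X\in\mathcal X$ is spanned by elements of $\mathcal B$, i.e. $X=\big\langle\bigcup_{Q\in\mathcal C}Q\big\rangle$ for some $\mathcal C\subset\mathcal B$. -/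

import Mathlib

/-- A set `P` of points with a family of subsets called lines (no axioms yet). -/
structure PointLineGeometry (P : Type*) where
  lines : Set (Set P)

namespace PointLineGeometry

variable {P : Type*}

/-- Two points are collinear if some line contains both of them; written `p ⊥ q` on paper.
In a partial linear space every point is collinear with itself. -/
def Collinear (G : PointLineGeometry P) (p q : P) : Prop :=
  ∃ ℓ ∈ G.lines, p ∈ ℓ ∧ q ∈ ℓ

/-- Every point of `X` is collinear with all points of `Y`. -/
def Perp (G : PointLineGeometry P) (X Y : Set P) : Prop :=
  ∀ p ∈ X, ∀ q ∈ Y, G.Collinear p q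

/-- Partial linear spaces. -/
structure IsPartialLinearSpace (G : PointLineGeometry P) : Prop where
  nonempty : Nonempty P
  line_proper : ∀ ℓ ∈ G.lines, ℓ ≠ Set.univ
  two_points : ∀ ℓ ∈ G.lines, ∃ p ∈ ℓ, ∃ q ∈ ℓ, p ≠ q
  exists_line : ∀ p : P, ∃ ℓ ∈ G.lines, p ∈ ℓ
  unique_line : ∀ p q : P, p ≠ q → ∀ ℓ₁ ∈ G.lines, ∀ ℓ₂ ∈ G.lines,
    p ∈ ℓ₁ → q ∈ ℓ₁ → p ∈ ℓ₂ → q ∈ ℓ₂ → ℓ₁ = ℓ₂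

/-- Subspaces: sets containing the line through any two of their distinct collinear points. -/
def IsSubspace (G : PointLineGeometry P) (S : Set P) : Prop :=
  ∀ p ∈ S, ∀ q ∈ S, p ≠ q → ∀ ℓ ∈ G.lines, p ∈ ℓ → q ∈ ℓ → ℓ ⊆ S

/-- Singular subspaces: subspaces any two distinct points of which are collinear. -/
def IsSingularSubspace (G : PointLineGeometry P) (S : Set P) : Prop :=
  G.IsSubspace S ∧ ∀ p ∈ S, ∀ q ∈ S, p ≠ q → G.Collinear p q

/-- The subspace `⟨X⟩` spanned by `X`: the intersection of all subspaces containing `X`. -/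
def span (G : PointLineGeometry P) (X : Set P) : Set P :=
  ⋂₀ {S | G.IsSubspace S ∧ X ⊆ S}

/-- `X` is independent if `⟨X⟩` is not spanned by a proper subset of `X`. -/
def Independent (G : PointLineGeometry P) (X : Set P) : Prop :=
  ∀ Y, Y ⊂ X → G.span Y ≠ G.span X

/-- `X` is a base of `S`. -/
def IsBase (G : PointLineGeometry P) (X S : Set P) : Prop :=
  X ⊆ S ∧ G.Independent X ∧ G.span X = S

/-- `S` has finite dimension `d`, i.e. `d` is the smallest number such that `S` has a base
consisting of `d + 1` points. The empty set has dimension `-1`, a point has dimension `0`. -/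
def HasDim (G : PointLineGeometry P) (S : Set P) (d : ℤ) : Prop :=
  IsLeast {j : ℤ | ∃ X : Set P, X.Finite ∧ G.IsBase X S ∧ (X.ncard : ℤ) = j + 1} d

/-- Polar spaces. -/
structure IsPolarSpace (G : PointLineGeometry P) : Prop extends G.IsPartialLinearSpace where
  three_points : ∀ ℓ ∈ G.lines, 3 ≤ ℓ.encard
  no_radical : ¬ ∃ p : P, ∀ q : P, q ≠ p → G.Collinear p q
  one_or_all : ∀ p : P, ∀ ℓ ∈ G.lines,
    (∃! q, q ∈ ℓ ∧ G.Collinear p q) ∨ ∀ q ∈ ℓ, G.Collinear p q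
  finite_flag : ∀ F : Set (Set P), (∀ S ∈ F, G.IsSingularSubspace S) →
    IsChain (· ⊆ ·) F → F.Finite

/-- Polar spaces of rank `n`: the dimension of the maximal singular subspaces is `n - 1`. -/
def IsPolarSpaceOfRank (G : PointLineGeometry P) (n : ℕ) : Prop :=
  G.IsPolarSpace ∧ ∀ M : Set P, Maximal G.IsSingularSubspace M → G.HasDim M ((n : ℤ) - 1)

/-- The set of all `k`-dimensional singular subspaces. -/
def Grassmannian (G : PointLineGeometry P) (k : ℤ) : Set (Set P) :=
  {S | G.IsSingularSubspace S ∧ G.HasDim S k}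

/-- `[S⟩_k`: all `k`-dimensional singular subspaces containing `S`. If `dim S = k - 1`, this is
a big star. -/
def above (G : PointLineGeometry P) (S : Set P) (k : ℤ) : Set (G.Grassmannian k) :=
  {X | S ⊆ X.1}

/-- `[S, U]_k`: all `k`-dimensional singular subspaces `X` with `S ⊆ X ⊆ U`. -/
def between (G : PointLineGeometry P) (S U : Set P) (k : ℤ) : Set (G.Grassmannian k) :=
  {X | S ⊆ X.1 ∧ X.1 ⊆ U}

/-- The Grassmann space of `k`-dimensional singular subspaces of a polar space of rank `n`, for
`0 ≤ k ≤ n - 2`. Its lines are the sets `[S, U]_k` for incident singular subspaces `S`, `U` of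
dimensions `k - 1` and `k + 1`. -/
def grassmannSpace (G : PointLineGeometry P) (k : ℤ) :
    PointLineGeometry (G.Grassmannian k) where
  lines := {ℓ | ∃ S ∈ G.Grassmannian (k - 1), ∃ U ∈ G.Grassmannian (k + 1),
    S ⊆ U ∧ ℓ = G.between S U k}

/-- The geometry induced on a set `A` of points: its lines are the lines contained in `A`. -/
def restrict (G : PointLineGeometry P) (A : Set P) : PointLineGeometry A where
  lines := {ℓ | Subtype.val '' ℓ ∈ G.lines}

/-- The polar space `[N⟩_k`, where `dim N = k - 1`, as a subspace of the Grassmann space. -/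
def starSpace (G : PointLineGeometry P) (N : Set P) (k : ℤ) :
    PointLineGeometry (G.above N k) :=
  (G.grassmannSpace k).restrict (G.above N k)

/-- The Grassmann graph on `k`-dimensional singular subspaces of a polar space of rank `n`:
`S` and `U` are adjacent if `dim (S ∩ U) = k - 1` and, when `k ≤ n - 2`, `S ⊥ U`. -/
def grassmannGraph (G : PointLineGeometry P) (n : ℕ) (k : ℤ) :
    SimpleGraph (G.Grassmannian k) where
  Adj S U := G.HasDim (S.1 ∩ U.1) (k - 1) ∧ (k ≤ (n : ℤ) - 2 → G.Perp S.1 U.1)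
  symm := ⟨by
    rintro S U ⟨h₁, h₂⟩
    refine ⟨by rwa [Set.inter_comm], fun h p hp q hq => ?_⟩
    obtain ⟨ℓ, hl, hq', hp'⟩ := h₂ h q hq p hp
    exact ⟨ℓ, hl, hp', hq'⟩⟩
  loopless := ⟨by
    rintro S ⟨h, -⟩
    rw [Set.inter_self] at h
    have := h.unique S.2.2
    omega⟩

/-- An `l`-frame: a set of `2 * l` points each of which is non-collinear with exactly one point
of the set. -/
def IsFrame (G : PointLineGeometry P) (l : ℕ) (B : Set P) : Prop :=
  B.encard = ((2 * l : ℕ) : ℕ∞) ∧ ∀ p ∈ B, ∃! q, q ∈ B ∧ ¬ G.Collinear p q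

end PointLineGeometry

/-- Singular subsets of `{1, …, n, -1, …, -n}`: those which do not contain `j` and `-j`
simultaneously. The pairs `(i, true)` and `(i, false)` stand for `i + 1` and `-(i + 1)`. -/
def IsSingularSubset {n : ℕ} (X : Finset (Fin n × Bool)) : Prop :=
  ∀ i b, (i, b) ∈ X → (i, !b) ∉ X

/-- The polar Johnson graph `PJ(n, k)`. -/
def polarJohnsonGraph (n k : ℕ) :
    SimpleGraph {X : Finset (Fin n × Bool) // IsSingularSubset X ∧ X.card = k + 1} where
  Adj X Y := (X.1 ∩ Y.1).card = k ∧ (k + 2 ≤ n → IsSingularSubset (X.1 ∪ Y.1))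
  symm := ⟨by
    rintro X Y ⟨h₁, h₂⟩
    exact ⟨by rwa [Finset.inter_comm], fun h => by rw [Finset.union_comm]; exact h₂ h⟩⟩
  loopless := ⟨by
    rintro X ⟨h, -⟩
    rw [Finset.inter_self, X.2.2] at h
    omega⟩

/-! ### Perps, cones and exchange in a polar space -/

namespace PointLineGeometry

variable {P : Type*} {G : PointLineGeometry P}

/-! Let f send the vertices of the polar Johnson graph to 𝒳. For a singular set A of m indices the
vertices A ∪ {x} form a star; for a singular set Y of m + 2 indices the vertices Y \ {y} form a top.
Among three pairwise adjacent k-dimensional subspaces, the third contains the intersection of the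
first two or lies in their join, so images of stars and tops are again of star or top type.
Everything rests on showing that f keeps the two types apart: stars go into big stars, tops into
(k+1)-dimensional subspaces.

Under condition 1, a top mapped into a big star would, by independence, span a singular subspace of
rank k + m + 2 > n (`subset_join_of_lt`). Hence tops stay tops; a star triple with images in a
(k+1)-dimensional subspace would then give non-adjacent vertices with adjacent images
(`preservesStars_of_tops`). Under condition 2, stars are so large that a star triple of top type
drags the images of two opposite vertices A ∪ {z}, A ∪ {-z} into one (k+1)-dimensional subspace,
where they are adjacent (`preservesStars_of_le`). If one top were then mapped into a big star,
exchanging indices one at a time would push all of 𝒳 into that big star (`exists_forall_subset`).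

Once types are kept, the images of each star have a common center of rank one less, and these
centers form a family of the same kind indexed by m-element sets (`IsTopFamily.descend`). Iterating
down to singletons yields subspaces Q x over a common N, and climbing back shows that f X is spanned
by the Q x with x ∈ X (`exists_frame`). Opposite Q x are not perpendicular, as f reflects adjacency,
so they form a frame of [N⟩.

The independence hypotheses are exploited through ranks. These require the dimension formula for
singular subspaces, which comes from the cone description of spans, and that in turn from lines
being double perps. -/

theorem Collinear.symm {p q : P} (h : G.Collinear p q) : G.Collinear q p :=
  let ⟨ℓ, hl, hp, hq⟩ := h
  ⟨ℓ, hl, hq, hp⟩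

theorem subset_span (X : Set P) : X ⊆ G.span X := fun _ hx _ hS => hS.2 hx

theorem span_subset {S X : Set P} (hS : G.IsSubspace S) (h : X ⊆ S) : G.span X ⊆ S :=
  fun _ hx => hx S ⟨hS, h⟩

theorem isSubspace_span (X : Set P) : G.IsSubspace (G.span X) :=
  fun p hp q hq hpq ℓ hl hpl hql _ hx S hS =>
    hS.1 p (hp S hS) q (hq S hS) hpq ℓ hl hpl hql hx

theorem span_mono {X Y : Set P} (h : X ⊆ Y) : G.span X ⊆ G.span Y :=
  span_subset (isSubspace_span Y) (h.trans (subset_span Y))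

theorem IsSubspace.span_eq {S : Set P} (hS : G.IsSubspace S) : G.span S = S :=
  (span_subset hS subset_rfl).antisymm (subset_span S)

theorem isSubspace_iInter {ι : Sort*} {f : ι → Set P} (h : ∀ i, G.IsSubspace (f i)) :
    G.IsSubspace (⋂ i, f i) := fun p hp q hq hpq ℓ hl hpl hql =>
  Set.subset_iInter fun i => h i p (Set.mem_iInter.1 hp i) q (Set.mem_iInter.1 hq i) hpq ℓ hl
    hpl hql

theorem IsSubspace.inter {S T : Set P} (hS : G.IsSubspace S) (hT : G.IsSubspace T) :
    G.IsSubspace (S ∩ T) := fun p hp q hq hpq ℓ hl hpl hql =>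
  Set.subset_inter (hS p hp.1 q hq.1 hpq ℓ hl hpl hql) (hT p hp.2 q hq.2 hpq ℓ hl hpl hql)

theorem isSubspace_empty : G.IsSubspace ∅ := fun _ hp => hp.elim

/-- A subspace without a point collinear with all its points. -/
def IsNondegenerate (G : PointLineGeometry P) (W : Set P) : Prop :=
  G.IsSubspace W ∧ ∀ x ∈ W, ∃ z ∈ W, ¬ G.Collinear x z

namespace IsPolarSpace

variable (h : G.IsPolarSpace)
include h

theorem collinear_refl (p : P) : G.Collinear p p :=
  let ⟨ℓ, hl, hp⟩ := h.exists_line p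
  ⟨ℓ, hl, hp, hp⟩

theorem collinear_of_mem_line {p a b x : P} {ℓ : Set P} (hl : ℓ ∈ G.lines) (ha : a ∈ ℓ)
    (hb : b ∈ ℓ) (hab : a ≠ b) (hpa : G.Collinear p a) (hpb : G.Collinear p b) (hx : x ∈ ℓ) :
    G.Collinear p x := by
  rcases h.one_or_all p ℓ hl with ⟨q, -, hq⟩ | hall
  · exact absurd ((hq a ⟨ha, hpa⟩).trans (hq b ⟨hb, hpb⟩).symm) hab
  · exact hall x hx

theorem exists_collinear_mem_line (p : P) {ℓ : Set P} (hl : ℓ ∈ G.lines) :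
    ∃ q ∈ ℓ, G.Collinear p q := by
  rcases h.one_or_all p ℓ hl with ⟨q, hq, -⟩ | hall
  · exact ⟨q, hq⟩
  · obtain ⟨a, ha, -⟩ := h.two_points ℓ hl
    exact ⟨a, ha, hall a ha⟩

theorem isNondegenerate_univ : G.IsNondegenerate Set.univ := by
  refine ⟨fun _ _ _ _ _ _ _ _ _ => Set.subset_univ _, fun x _ => ?_⟩
  by_contra hx
  push Not at hx
  exact h.no_radical ⟨x, fun q _ => hx q (Set.mem_univ q)⟩

theorem isSubspace_collinear (p : P) : G.IsSubspace {q | G.Collinear p q} :=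
  fun _ ha _ hb hab _ hl hal hbl _ hx => h.collinear_of_mem_line hl hal hbl hab ha hb hx

/-- In a nondegenerate subspace, collinear points have incomparable perps. -/
theorem exists_collinear_not_collinear {W : Set P} (hW : G.IsNondegenerate W) {d e : P}
    (hd : d ∈ W) (he : e ∈ W) (hde : d ≠ e) (hcol : G.Collinear d e) :
    ∃ r ∈ W, G.Collinear r d ∧ ¬ G.Collinear r e := by
  by_contra H
  push Not at H
  obtain ⟨ℓ, hl, hdl, hel⟩ := hcol
  obtain ⟨r₀, hr₀, hr₀e⟩ := hW.2 e he
  have hr₀d : ¬ G.Collinear r₀ d := fun hc => hr₀e (H r₀ hr₀ hc).symm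
  -- Choose t on the line de collinear with r₀, u not collinear with t, r₁ on the line r₀t collinear
  -- with u, and w on the line ur₁ collinear with d. By `H` the point w is collinear with e too,
  -- hence with t; then t is collinear with w and r₁, hence with u, a contradiction.
  obtain ⟨t, htl, ht⟩ := h.exists_collinear_mem_line r₀ hl
  have htW : t ∈ W := hW.1 d hd e he hde ℓ hl hdl hel htl
  obtain ⟨u, hu, hut⟩ := hW.2 t htW
  obtain ⟨m, hm, hrm, htm⟩ := ht
  have hne : r₀ ≠ t := by
    rintro rfl
    exact hr₀e ⟨ℓ, hl, hel, htl⟩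
  obtain ⟨r₁, hr₁m, hr₁⟩ := h.exists_collinear_mem_line u hm
  have hr₁W : r₁ ∈ W := hW.1 r₀ hr₀ t htW hne m hm hrm htm hr₁m
  have hr₁t : r₁ ≠ t := by
    rintro rfl
    exact hut hr₁.symm
  have hr₁d : ¬ G.Collinear d r₁ := fun hc =>
    hr₀d (h.collinear_of_mem_line hm hr₁m htm hr₁t hc ⟨ℓ, hl, hdl, htl⟩ hrm).symm
  have hur : u ≠ r₁ := by
    rintro rfl
    exact hut ⟨m, hm, htm, hr₁m⟩
  obtain ⟨m', hm', hum', hrm'⟩ := hr₁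
  obtain ⟨w, hwm', hdw⟩ := h.exists_collinear_mem_line d hm'
  have hwW : w ∈ W := hW.1 u hu r₁ hr₁W hur m' hm' hum' hrm' hwm'
  have hwt := h.collinear_of_mem_line hl hdl hel hde hdw.symm (H w hwW hdw.symm) htl
  have hwr : w ≠ r₁ := by
    rintro rfl
    exact hr₁d hdw
  exact hut (h.collinear_of_mem_line hm' hwm' hrm' hwr hwt.symm ⟨m, hm, htm, hr₁m⟩ hum')

/-- A point x of the radical would be collinear with a and with a point of q^⊥ on every line of W
through a, hence with all of a^⊥ ∩ W, against `exists_collinear_not_collinear`. The point q need not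
lie in W. -/
theorem isNondegenerate_perp {W : Set P} (hW : G.IsNondegenerate W) {a q : P} (ha : a ∈ W)
    (haq : ¬ G.Collinear a q) :
    G.IsNondegenerate (W ∩ ({x | G.Collinear a x} ∩ {x | G.Collinear q x})) := by
  refine ⟨hW.1.inter ((h.isSubspace_collinear a).inter (h.isSubspace_collinear q)), ?_⟩
  rintro x ⟨hxW, hax, hqx⟩
  by_contra H
  push Not at H
  have hne : a ≠ x := by
    rintro rfl
    exact haq (Collinear.symm hqx)
  obtain ⟨r, hr, hra, hrx⟩ := h.exists_collinear_not_collinear hW ha hxW hne hax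
  obtain ⟨m, hm, hrm, ham⟩ := hra
  obtain ⟨z, hzm, hqz⟩ := h.exists_collinear_mem_line q hm
  have hra : r ≠ a := by
    rintro rfl
    exact hrx hax
  have hza : z ≠ a := by
    rintro rfl
    exact haq hqz.symm
  have hzW : z ∈ W := hW.1 r hr a ha hra m hm hrm ham hzm
  exact hrx (h.collinear_of_mem_line hm hzm ham hza (H z ⟨hzW, ⟨m, hm, ham, hzm⟩, hqz⟩)
    (Collinear.symm hax) hrm).symm

/-- A line is the double perp of any two of its points. -/
theorem exists_collinear_pair_not_collinear {W : Set P} (hW : G.IsNondegenerate W) {a b c : P}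
    {ℓ : Set P} (hl : ℓ ∈ G.lines) (hal : a ∈ ℓ) (hbl : b ∈ ℓ) (hab : a ≠ b) (hcl : c ∉ ℓ)
    (ha : a ∈ W) (hb : b ∈ W) (hc : c ∈ W) (hca : G.Collinear c a) (hcb : G.Collinear c b) :
    ∃ r ∈ W, G.Collinear r a ∧ G.Collinear r b ∧ ¬ G.Collinear r c := by
  obtain ⟨q, hq, haq⟩ := hW.2 a ha
  obtain ⟨m, hm, hcm, ham⟩ := id hca
  obtain ⟨d, hdl, hqd⟩ := h.exists_collinear_mem_line q hl
  obtain ⟨e, hem, hqe⟩ := h.exists_collinear_mem_line q hm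
  have hda : d ≠ a := by
    rintro rfl
    exact haq hqd.symm
  have hea : e ≠ a := by
    rintro rfl
    exact haq hqe.symm
  have hac : c ≠ a := by
    rintro rfl
    exact hcl hal
  have hdW : d ∈ W := hW.1 a ha b hb hab ℓ hl hal hbl hdl
  have heW : e ∈ W := hW.1 c hc a ha hac m hm hcm ham hem
  have hde : d ≠ e := by
    rintro rfl
    exact hcl (h.unique_line d a hda ℓ hl m hm hdl hal hem ham ▸ hcm)
  have hcd := h.collinear_of_mem_line hl hal hbl hab hca hcb hdl
  have hcol := h.collinear_of_mem_line hm hcm ham hac hcd.symm ⟨ℓ, hl, hdl, hal⟩ hem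
  -- In {a, q}^⊥ the points d and e represent the lines ab and ac through a, so a point separating d
  -- from e there separates the two lines.
  obtain ⟨r, ⟨hrW, har, -⟩, hrd, hre⟩ := h.exists_collinear_not_collinear
    (h.isNondegenerate_perp hW ha haq) ⟨hdW, ⟨ℓ, hl, hal, hdl⟩, hqd⟩ ⟨heW, ⟨m, hm, ham, hem⟩, hqe⟩
    hde hcol
  have har' := Collinear.symm har
  exact ⟨r, hrW, har', h.collinear_of_mem_line hl hdl hal hda hrd har' hbl,
    fun hrc => hre (h.collinear_of_mem_line hm hcm ham hac hrc har' hem)⟩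

/-- The Veblen property of singular planes. -/
theorem exists_mem_line_meet {p a b z : P} {ℓ : Set P} (hl : ℓ ∈ G.lines) (hal : a ∈ ℓ)
    (hbl : b ∈ ℓ) (hab : a ≠ b) (hpl : p ∉ ℓ) (hpa : G.Collinear p a) (hpb : G.Collinear p b)
    (hzp : z ≠ p)
    (H : ∀ r, G.Collinear r p → G.Collinear r a → G.Collinear r b → G.Collinear r z) :
    ∃ v ∈ ℓ, ∃ m ∈ G.lines, v ∈ m ∧ p ∈ m ∧ z ∈ m := by
  have hcol : G.Collinear a b := ⟨ℓ, hl, hal, hbl⟩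
  obtain ⟨q, -, hqa, hqb, hqp⟩ := h.exists_collinear_pair_not_collinear h.isNondegenerate_univ hl
    hal hbl hab hpl (Set.mem_univ _) (Set.mem_univ _) (Set.mem_univ _) hpa hpb
  obtain ⟨m, hm, hpm, hzm⟩ := H p (h.collinear_refl p) hpa hpb
  obtain ⟨v, hvm, hqv⟩ := h.exists_collinear_mem_line q hm
  refine ⟨v, ?_, m, hm, hvm, hpm, hzm⟩
  -- If v were off ℓ, then inside {p, q}^⊥, which contains a, b and v, some r would be collinear
  -- with a and b but not with v. But r is collinear with p, a, b, so by `H` with z, and thus with v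
  -- on the line pz.
  by_contra hvl
  have hva := (h.collinear_of_mem_line hm hpm hzm hzp.symm hpa.symm
    (H a hpa.symm (h.collinear_refl a) hcol) hvm).symm
  have hvb := (h.collinear_of_mem_line hm hpm hzm hzp.symm hpb.symm
    (H b hpb.symm hcol.symm (h.collinear_refl b)) hvm).symm
  have hpq : ¬ G.Collinear p q := fun hc => hqp hc.symm
  obtain ⟨r, ⟨-, hpr, -⟩, hra, hrb, hrv⟩ := h.exists_collinear_pair_not_collinear
    (h.isNondegenerate_perp h.isNondegenerate_univ (Set.mem_univ p) hpq) hl hal hbl hab hvl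
    ⟨Set.mem_univ _, hpa, hqa⟩ ⟨Set.mem_univ _, hpb, hqb⟩
    ⟨Set.mem_univ _, ⟨m, hm, hpm, hvm⟩, hqv⟩ hva hvb
  have hrp := Collinear.symm hpr
  exact hrv (h.collinear_of_mem_line hm hpm hzm hzp.symm hrp (H r hrp hra hrb) hvm)

theorem isSingularSubspace_span {X : Set P} (hX : ∀ p ∈ X, ∀ q ∈ X, G.Collinear p q) :
    G.IsSingularSubspace (G.span X) := by
  have h₁ : ∀ p ∈ X, ∀ q ∈ G.span X, G.Collinear p q := fun p hp =>
    span_subset (h.isSubspace_collinear p) (hX p hp)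
  exact ⟨isSubspace_span X, fun q hq p hp _ =>
    span_subset (h.isSubspace_collinear q) (fun p hp => (h₁ p hp q hq).symm) hp⟩

end IsPolarSpace

theorem IsSingularSubspace.collinear {S : Set P} (hS : G.IsSingularSubspace S)
    (h : G.IsPolarSpace) {p q : P} (hp : p ∈ S) (hq : q ∈ S) : G.Collinear p q := by
  rcases eq_or_ne p q with rfl | hne
  · exact h.collinear_refl p
  · exact hS.2 p hp q hq hne

theorem IsSingularSubspace.mono {S T : Set P} (hT : G.IsSingularSubspace T)
    (hS : G.IsSubspace S) (hST : S ⊆ T) : G.IsSingularSubspace S :=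
  ⟨hS, fun p hp q hq => hT.2 p (hST hp) q (hST hq)⟩

theorem IsSingularSubspace.inter {S T : Set P} (hS : G.IsSingularSubspace S)
    (hT : G.IsSubspace T) : G.IsSingularSubspace (S ∩ T) :=
  hS.mono (hS.1.inter hT) Set.inter_subset_left

theorem Perp.symm {X Y : Set P} (h : G.Perp X Y) : G.Perp Y X :=
  fun q hq p hp => (h p hp q hq).symm

theorem IsSingularSubspace.perp {S X Y : Set P} (hS : G.IsSingularSubspace S)
    (h : G.IsPolarSpace) (hX : X ⊆ S) (hY : Y ⊆ S) : G.Perp X Y :=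
  fun _ hp _ hq => hS.collinear h (hX hp) (hY hq)

namespace IsPolarSpace

variable (h : G.IsPolarSpace)
include h

theorem perp_span {X Y : Set P} (hXY : G.Perp X Y) : G.Perp X (G.span Y) := fun p hp =>
  span_subset (h.isSubspace_collinear p) (hXY p hp)

theorem isSingularSubspace_join {A B : Set P} (hA : G.IsSingularSubspace A)
    (hB : G.IsSingularSubspace B) (hAB : G.Perp A B) : G.IsSingularSubspace (G.span (A ∪ B)) := by
  apply h.isSingularSubspace_span
  rintro p (hp | hp) q (hq | hq)
  exacts [hA.collinear h hp hq, hAB p hp q hq, (hAB q hq p hp).symm, hB.collinear h hp hq]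

theorem isSingularSubspace_span_insert {A : Set P} {p : P} (hA : G.IsSingularSubspace A)
    (hp : ∀ a ∈ A, G.Collinear p a) : G.IsSingularSubspace (G.span (insert p A)) := by
  apply h.isSingularSubspace_span
  rintro x (rfl | hx) y (rfl | hy)
  exacts [h.collinear_refl _, hp y hy, (hp x hx).symm, hA.collinear h hx hy]

/-- The span of a singular subspace and a point collinear with it is a cone. -/
theorem mem_span_insert {A : Set P} {p x : P} (hA : G.IsSingularSubspace A)
    (hp : ∀ a ∈ A, G.Collinear p a) (hpA : p ∉ A) (hx : x ∈ G.span (insert p A)) :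
    x = p ∨ ∃ a ∈ A, ∃ ℓ ∈ G.lines, a ∈ ℓ ∧ p ∈ ℓ ∧ x ∈ ℓ := by
  refine span_subset (S := {x | x = p ∨ ∃ a ∈ A, ∃ ℓ ∈ G.lines, a ∈ ℓ ∧ p ∈ ℓ ∧ x ∈ ℓ}) ?_ ?_ hx
  · have key : ∀ a ∈ A, ∀ b ∈ A, ∀ ℓ₁ ∈ G.lines, ∀ ℓ₂ ∈ G.lines, a ∈ ℓ₁ → p ∈ ℓ₁ → b ∈ ℓ₂ →
        p ∈ ℓ₂ → ∀ x ∈ ℓ₁, ∀ y ∈ ℓ₂, x ≠ y → ∀ ℓ ∈ G.lines, x ∈ ℓ → y ∈ ℓ → ∀ z ∈ ℓ,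
        z = p ∨ ∃ a ∈ A, ∃ ℓ ∈ G.lines, a ∈ ℓ ∧ p ∈ ℓ ∧ z ∈ ℓ := by
      intro a ha b hb ℓ₁ hl₁ ℓ₂ hl₂ ha₁ hp₁ hb₂ hp₂ x hx y hy hxy ℓ hl hxl hyl z hz
      have hpa : p ≠ a := by
        rintro rfl
        exact hpA ha
      have hpb : p ≠ b := by
        rintro rfl
        exact hpA hb
      rcases eq_or_ne z p with rfl | hzp
      · exact Or.inl rfl
      right
      rcases eq_or_ne a b with rfl | hab
      · obtain rfl := h.unique_line p a hpa ℓ₁ hl₁ ℓ₂ hl₂ hp₁ ha₁ hp₂ hb₂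
        obtain rfl := h.unique_line x y hxy ℓ hl ℓ₁ hl₁ hxl hyl hx hy
        exact ⟨a, ha, ℓ, hl, ha₁, hp₁, hz⟩
      · obtain ⟨m, hm, ham, hbm⟩ := hA.2 a ha b hb hab
        have hmA := hA.1 a ha b hb hab m hm ham hbm
        -- A point collinear with p, a and b is collinear with x and y, hence with z, so the line pz
        -- meets the line ab, which lies in the base A of the cone.
        obtain ⟨v, hv, m', hm', h'⟩ := h.exists_mem_line_meet hm ham hbm hab
          (fun hpm => hpA (hmA hpm)) (hp a ha) (hp b hb) hzp fun r hrp hra hrb =>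
            h.collinear_of_mem_line hl hxl hyl hxy
              (h.collinear_of_mem_line hl₁ ha₁ hp₁ hpa.symm hra hrp hx)
              (h.collinear_of_mem_line hl₂ hb₂ hp₂ hpb.symm hrb hrp hy) hz
        exact ⟨v, hmA hv, m', hm', h'⟩
    rintro x (rfl | ⟨a, ha, ℓ₁, hl₁, ha₁, hp₁, hx₁⟩) y (rfl | ⟨b, hb, ℓ₂, hl₂, hb₂, hp₂, hy₂⟩)
      hxy ℓ hl hxl hyl z hz
    · exact absurd rfl hxy
    · exact key b hb b hb ℓ₂ hl₂ ℓ₂ hl₂ hb₂ hp₂ hb₂ hp₂ x hp₂ y hy₂ hxy ℓ hl hxl hyl z hz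
    · exact key a ha a ha ℓ₁ hl₁ ℓ₁ hl₁ ha₁ hp₁ ha₁ hp₁ x hx₁ y hp₁ hxy ℓ hl hxl hyl z hz
    · exact key a ha b hb ℓ₁ hl₁ ℓ₂ hl₂ ha₁ hp₁ hb₂ hp₂ x hx₁ y hy₂ hxy ℓ hl hxl hyl z hz
  · rintro x (rfl | hx)
    · exact Or.inl rfl
    · obtain ⟨ℓ, hl, hpl, hxl⟩ := hp x hx
      exact Or.inr ⟨x, hx, ℓ, hl, hxl, hpl, hxl⟩

/-- The exchange property. -/
theorem mem_span_insert_exchange {A : Set P} {p q : P} (hA : G.IsSingularSubspace A)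
    (hp : ∀ a ∈ A, G.Collinear p a) (hq : q ∈ G.span (insert p A)) (hqA : q ∉ A) :
    p ∈ G.span (insert q A) := by
  by_cases hpA : p ∈ A
  · exact subset_span _ (Set.mem_insert_of_mem _ hpA)
  rcases h.mem_span_insert hA hp hpA hq with rfl | ⟨a, ha, ℓ, hl, hal, hpl, hql⟩
  · exact subset_span _ (Set.mem_insert _ _)
  · refine isSubspace_span (insert q A) q (subset_span _ (Set.mem_insert _ _)) a
      (subset_span _ (Set.mem_insert_of_mem _ ha)) ?_ ℓ hl hql hal hpl
    rintro rfl
    exact hqA ha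

end IsPolarSpace

/-! ### Rank and the dimension formula -/

/-- `S` is spanned by at most `d` points. -/
def IsGeneratedBy (G : PointLineGeometry P) (d : ℕ) (S : Set P) : Prop :=
  ∃ X : Finset P, X.card ≤ d ∧ G.span (X : Set P) = S

theorem span_insert_span (p : P) (X : Set P) :
    G.span (insert p (G.span X)) = G.span (insert p X) := by
  apply (span_subset (isSubspace_span _) _).antisymm
    (span_mono (Set.insert_subset_insert (subset_span X)))
  exact Set.insert_subset (subset_span _ (Set.mem_insert _ _))
    (span_mono (Set.subset_insert _ _))

theorem IsGeneratedBy.span_insert {d : ℕ} {A : Set P} (hA : G.IsGeneratedBy d A) (p : P) :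
    G.IsGeneratedBy (d + 1) (G.span (insert p A)) := by
  classical
  obtain ⟨X, hX, rfl⟩ := hA
  exact ⟨insert p X, (Finset.card_insert_le _ _).trans (by omega),
    by rw [span_insert_span, Finset.coe_insert]⟩

/-- Drop a generator p of B, leaving a span C. If A is not inside C, any a ∈ A \ C can replace p by
exchange, and the cone description gives the modular law A = ⟨a, A ∩ C⟩; the induction hypothesis
applies to A ∩ C in C. The strict part makes rank strictly monotone. -/
theorem IsPolarSpace.isGeneratedBy_of_subset (h : G.IsPolarSpace) (d : ℕ) :
    ∀ B, G.IsSingularSubspace B → G.IsGeneratedBy d B → ∀ A ⊆ B, G.IsSubspace A →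
      G.IsGeneratedBy d A ∧ (A ≠ B → ∃ e < d, G.IsGeneratedBy e A) := by
  classical
  induction d with
  | zero =>
    rintro B - ⟨X, hX, rfl⟩ A hAB -
    obtain rfl : X = ∅ := Finset.card_eq_zero.1 (by omega)
    rw [Finset.coe_empty, isSubspace_empty.span_eq] at hAB ⊢
    obtain rfl := Set.subset_empty_iff.1 hAB
    exact ⟨⟨∅, by simp, by simp [isSubspace_empty.span_eq]⟩, fun h => absurd rfl h⟩
  | succ d ih =>
    rintro B hB ⟨X, hX, rfl⟩ A hAB hA
    have small : ∀ {B : Set P}, G.IsSingularSubspace B → A ⊆ B → G.IsGeneratedBy d B →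
        G.IsGeneratedBy (d + 1) A ∧ ∃ e < d + 1, G.IsGeneratedBy e A := fun hB hAB hgen => by
      obtain ⟨Y, hY, hY'⟩ := (ih _ hB hgen A hAB hA).1
      exact ⟨⟨Y, by omega, hY'⟩, d, by omega, Y, hY, hY'⟩
    rcases X.eq_empty_or_nonempty with rfl | ⟨p, hp⟩
    · exact (small hB hAB ⟨∅, by simp, rfl⟩).imp_right fun h _ => h
    set C := G.span ((X.erase p : Finset P) : Set P) with hC
    have hCgen : G.IsGeneratedBy d C :=
      ⟨X.erase p, by rw [Finset.card_erase_of_mem hp]; omega, rfl⟩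
    have hCB : C ⊆ G.span X := span_mono (by simp)
    have hpB : p ∈ G.span (X : Set P) := subset_span _ hp
    have hCs := hB.mono (isSubspace_span _) hCB
    have hBC : G.span (X : Set P) = G.span (insert p C) := by
      rw [hC, span_insert_span, ← Finset.coe_insert, Finset.insert_erase hp]
    have hpC : ∀ c ∈ C, G.Collinear p c := fun c hc => hB.collinear h hpB (hCB hc)
    by_cases hAC : A ⊆ C
    · exact (small hCs hAC hCgen).imp_right fun h _ => h
    obtain ⟨a, ha, haC⟩ := Set.not_subset.1 hAC
    have hpa := h.mem_span_insert_exchange hCs hpC (hBC ▸ hAB ha) haC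
    have hBa : G.span (X : Set P) ⊆ G.span (insert a C) := by
      rw [hBC]
      exact span_subset (isSubspace_span _)
        (Set.insert_subset hpa ((Set.subset_insert _ _).trans (subset_span _)))
    have haC' : ∀ c ∈ C, G.Collinear a c := fun c hc => hB.collinear h (hAB ha) (hCB hc)
    have hAeq : G.span (insert a (A ∩ C)) = A := by
      refine (span_subset hA (Set.insert_subset ha Set.inter_subset_left)).antisymm fun x hx => ?_
      rcases h.mem_span_insert hCs haC' haC (hBa (hAB hx)) with rfl | ⟨c, hc, ℓ, hl, hcl, hal, hxl⟩
      · exact subset_span _ (Set.mem_insert _ _)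
      rcases eq_or_ne a x with rfl | hax
      · exact subset_span _ (Set.mem_insert _ _)
      have hcA : c ∈ A := hA a ha x hx hax ℓ hl hal hxl hcl
      refine isSubspace_span (insert a (A ∩ C)) a (subset_span _ (Set.mem_insert _ _)) c
        (subset_span _ (Set.mem_insert_of_mem _ ⟨hcA, hc⟩)) ?_ ℓ hl hal hcl hxl
      rintro rfl
      exact haC hc
    obtain ⟨hgen, hlt⟩ := ih C hCs hCgen (A ∩ C) Set.inter_subset_right (hA.inter hCs.1)
    refine ⟨hAeq ▸ hgen.span_insert a, fun hne => ?_⟩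
    obtain ⟨e, he, hgen'⟩ := hlt fun heq => hne <| hAB.antisymm <| hBa.trans <|
      span_subset hA (Set.insert_subset ha (Set.inter_eq_right.1 heq))
    exact ⟨e + 1, by omega, hAeq ▸ hgen'.span_insert a⟩

theorem isSingularSubspace_sUnion {F : Set (Set P)} (hF : ∀ S ∈ F, G.IsSingularSubspace S)
    (hc : IsChain (· ⊆ ·) F) : G.IsSingularSubspace (⋃₀ F) := by
  have key : ∀ p ∈ ⋃₀ F, ∀ q ∈ ⋃₀ F, ∃ S ∈ F, p ∈ S ∧ q ∈ S := by
    rintro p ⟨S, hS, hp⟩ q ⟨T, hT, hq⟩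
    rcases hc.total hS hT with hST | hTS
    · exact ⟨T, hT, hST hp, hq⟩
    · exact ⟨S, hS, hp, hTS hq⟩
  refine ⟨fun p hp q hq hpq ℓ hl hpl hql => ?_, fun p hp q hq hpq => ?_⟩
  · obtain ⟨S, hS, hp, hq⟩ := key p hp q hq
    exact ((hF S hS).1 p hp q hq hpq ℓ hl hpl hql).trans (Set.subset_sUnion_of_mem hS)
  · obtain ⟨S, hS, hp, hq⟩ := key p hp q hq
    exact (hF S hS).2 p hp q hq hpq

theorem IsSingularSubspace.exists_maximal {S : Set P} (hS : G.IsSingularSubspace S) :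
    ∃ M, S ⊆ M ∧ Maximal G.IsSingularSubspace M :=
  zorn_subset_nonempty {S | G.IsSingularSubspace S}
    (fun F hF hc _ => ⟨⋃₀ F, isSingularSubspace_sUnion (fun _ h => hF h) hc,
      fun _ => Set.subset_sUnion_of_mem⟩) S hS

/-- The least number of points spanning `S`. -/
noncomputable def rank (G : PointLineGeometry P) (S : Set P) : ℕ :=
  sInf {d | G.IsGeneratedBy d S}

theorem rank_le_of_isGeneratedBy {d : ℕ} {S : Set P} (h : G.IsGeneratedBy d S) : G.rank S ≤ d :=
  Nat.sInf_le h

namespace IsPolarSpaceOfRank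

variable {n : ℕ} (hG : G.IsPolarSpaceOfRank n)
include hG

theorem isGeneratedBy {S : Set P} (hS : G.IsSingularSubspace S) : G.IsGeneratedBy n S := by
  obtain ⟨M, hSM, hM⟩ := hS.exists_maximal
  obtain ⟨X, hXf, hX, hc⟩ := (hG.2 M hM).1
  refine (hG.1.isGeneratedBy_of_subset n M hM.1 ⟨hXf.toFinset, ?_, ?_⟩ S hSM hS.1).1
  · rw [← Set.ncard_eq_toFinset_card X hXf]
    omega
  · rw [hXf.coe_toFinset, hX.2.2]

theorem isGeneratedBy_rank {S : Set P} (hS : G.IsSingularSubspace S) :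
    G.IsGeneratedBy (G.rank S) S :=
  Nat.sInf_mem (s := {d | G.IsGeneratedBy d S}) ⟨n, hG.isGeneratedBy hS⟩

theorem rank_le {S : Set P} (hS : G.IsSingularSubspace S) : G.rank S ≤ n :=
  rank_le_of_isGeneratedBy (hG.isGeneratedBy hS)

/-- A spanning set with the fewest points is automatically independent, so the smallest base has
`rank` many points. -/
theorem hasDim_iff {S : Set P} (hS : G.IsSingularSubspace S) {d : ℤ} :
    G.HasDim S d ↔ (G.rank S : ℤ) = d + 1 := by
  have hlow : ∀ X : Set P, X.Finite → G.span X = S → G.rank S ≤ X.ncard := fun X hX hs =>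
    rank_le_of_isGeneratedBy ⟨hX.toFinset, (Set.ncard_eq_toFinset_card X hX).ge,
      by rw [hX.coe_toFinset, hs]⟩
  have hleast : G.HasDim S ((G.rank S : ℤ) - 1) := by
    refine ⟨?_, ?_⟩
    · obtain ⟨X, hX, hs⟩ := hG.isGeneratedBy_rank hS
      have hge := hlow X X.finite_toSet hs
      rw [Set.ncard_coe_finset] at hge
      refine ⟨X, X.finite_toSet, ⟨hs ▸ subset_span _, fun Y hY hsY => ?_, hs⟩, ?_⟩
      · have := hlow Y (X.finite_toSet.subset hY.subset) (hsY.trans hs)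
        have := Set.ncard_lt_ncard hY X.finite_toSet
        rw [Set.ncard_coe_finset] at this
        omega
      · rw [Set.ncard_coe_finset]
        omega
    · rintro j ⟨X, hXf, hX, hc⟩
      have := hlow X hXf hX.2.2
      omega
  constructor
  · intro hd
    have := hd.unique hleast
    omega
  · intro hd
    obtain rfl : d = (G.rank S : ℤ) - 1 := by omega
    exact hleast

theorem mem_grassmannian {S : Set P} {d : ℤ} :
    S ∈ G.Grassmannian d ↔ G.IsSingularSubspace S ∧ (G.rank S : ℤ) = d + 1 :=
  and_congr_right fun hS => hG.hasDim_iff hS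

theorem rank_maximal {M : Set P} (hM : Maximal G.IsSingularSubspace M) : G.rank M = n := by
  have := (hG.hasDim_iff hM.1).1 (hG.2 M hM)
  omega

theorem rank_lt {A B : Set P} (hB : G.IsSingularSubspace B) (hA : G.IsSubspace A)
    (hAB : A ⊆ B) (hne : A ≠ B) : G.rank A < G.rank B := by
  obtain ⟨e, he, hgen⟩ := (hG.1.isGeneratedBy_of_subset _ B hB (hG.isGeneratedBy_rank hB) A hAB
    hA).2 hne
  exact (rank_le_of_isGeneratedBy hgen).trans_lt he

theorem rank_mono {A B : Set P} (hB : G.IsSingularSubspace B) (hA : G.IsSubspace A)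
    (hAB : A ⊆ B) : G.rank A ≤ G.rank B := by
  rcases eq_or_ne A B with rfl | hne
  exacts [le_rfl, (hG.rank_lt hB hA hAB hne).le]

theorem eq_of_subset_of_rank_le {A B : Set P} (hB : G.IsSingularSubspace B)
    (hA : G.IsSubspace A) (hAB : A ⊆ B) (hr : G.rank B ≤ G.rank A) : A = B := by
  by_contra hne
  exact absurd (hG.rank_lt hB hA hAB hne) (by omega)

theorem rank_span_insert {A : Set P} {p : P} (hA : G.IsSingularSubspace A)
    (hp : ∀ a ∈ A, G.Collinear p a) (hpA : p ∉ A) :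
    G.rank (G.span (insert p A)) = G.rank A + 1 := by
  apply (rank_le_of_isGeneratedBy ((hG.isGeneratedBy_rank hA).span_insert p)).antisymm
  refine hG.rank_lt (hG.1.isSingularSubspace_span_insert hA hp) hA.1
    ((Set.subset_insert _ _).trans (subset_span _)) fun heq => hpA ?_
  rw [heq]
  exact subset_span _ (Set.mem_insert _ _)

/-- The dimension formula. -/
theorem rank_join_add_rank_inter {A B : Set P} (hA : G.IsSingularSubspace A)
    (hB : G.IsSingularSubspace B) (hAB : G.Perp A B) :
    G.rank (G.span (A ∪ B)) + G.rank (A ∩ B) = G.rank A + G.rank B := by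
  induction hd : G.rank B - G.rank (A ∩ B) using Nat.strong_induction_on generalizing A with
  | _ d ih =>
  by_cases hBA : B ⊆ A
  · rw [Set.union_eq_left.2 hBA, Set.inter_eq_right.2 hBA, hA.1.span_eq]
  -- Adding b to A leaves the join with B unchanged and raises the ranks of both A and A ∩ B by one,
  -- so the formula for the larger pair gives the one for A and B.
  obtain ⟨b, hb, hbA⟩ := Set.not_subset.1 hBA
  have hbcol : ∀ a ∈ A, G.Collinear b a := fun a ha => (hAB a ha b hb).symm
  have hA' := hG.1.isSingularSubspace_span_insert hA hbcol
  have hA'B : G.Perp (G.span (insert b A)) B := by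
    refine (hG.1.perp_span ?_).symm
    rintro x hx y (rfl | hy)
    exacts [hB.collinear hG.1 hx hb, (hAB y hy x hx).symm]
  have hjoin : G.span (G.span (insert b A) ∪ B) = G.span (A ∪ B) := by
    apply (span_subset (isSubspace_span _) _).antisymm
      (span_mono (Set.union_subset_union_left _ ((Set.subset_insert _ _).trans (subset_span _))))
    refine Set.union_subset (span_mono ?_) (Set.subset_union_right.trans (subset_span _))
    exact Set.insert_subset (Or.inr hb) Set.subset_union_left
  have hinter : G.span (insert b A) ∩ B = G.span (insert b (A ∩ B)) := by
    apply Set.Subset.antisymm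
    · rintro x ⟨hx, hxB⟩
      rcases hG.1.mem_span_insert hA hbcol hbA hx with rfl | ⟨a, ha, ℓ, hl, hal, hbl, hxl⟩
      · exact subset_span _ (Set.mem_insert _ _)
      rcases eq_or_ne b x with rfl | hbx
      · exact subset_span _ (Set.mem_insert _ _)
      have haB : a ∈ B := hB.1 b hb x hxB hbx ℓ hl hbl hxl hal
      refine isSubspace_span (insert b (A ∩ B)) b (subset_span _ (Set.mem_insert _ _)) a
        (subset_span _ (Set.mem_insert_of_mem _ ⟨ha, haB⟩)) ?_ ℓ hl hbl hal hxl
      rintro rfl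
      exact hbA ha
    · exact Set.subset_inter (span_mono (Set.insert_subset_insert Set.inter_subset_left))
        (span_subset hB.1 (Set.insert_subset hb Set.inter_subset_right))
  have h₁ := hG.rank_span_insert hA hbcol hbA
  have h₂ := hG.rank_span_insert (hA.inter hB.1) (fun a ha => hbcol a ha.1) fun hb' => hbA hb'.1
  have h₃ : G.rank (A ∩ B) < G.rank B := hG.rank_lt hB (hA.1.inter hB.1) Set.inter_subset_right
    fun heq => hBA (Set.inter_eq_right.1 heq)
  have h₄ := ih _ (by rw [hinter, h₂]; omega) hA' hA'B rfl
  rw [hinter, hjoin, h₁, h₂] at h₄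
  omega

theorem exists_superset_rank_succ {A : Set P} (hA : G.IsSingularSubspace A)
    (hr : G.rank A < n) : ∃ B, G.IsSingularSubspace B ∧ A ⊆ B ∧ G.rank B = G.rank A + 1 := by
  obtain ⟨M, hAM, hM⟩ := hA.exists_maximal
  obtain ⟨p, hp, hpA⟩ : ∃ p ∈ M, p ∉ A := by
    by_contra H
    push Not at H
    obtain rfl := hAM.antisymm H
    exact hr.ne (hG.rank_maximal hM)
  have hcol : ∀ a ∈ A, G.Collinear p a := fun a ha => hM.1.collinear hG.1 hp (hAM ha)
  exact ⟨_, hG.1.isSingularSubspace_span_insert hA hcol,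
    (Set.subset_insert _ _).trans (subset_span _), hG.rank_span_insert hA hcol hpA⟩

theorem rank_inter_of_hyperplanes {A B U : Set P} {r : ℕ} (hU : G.IsSingularSubspace U)
    (hA : G.IsSubspace A) (hB : G.IsSubspace B) (hAU : A ⊆ U) (hBU : B ⊆ U)
    (hrU : G.rank U = r + 1) (hrA : G.rank A = r) (hrB : G.rank B = r) (hne : A ≠ B) :
    G.rank (A ∩ B) + 1 = r ∧ G.span (A ∪ B) = U := by
  have hAs := hU.mono hA hAU
  have hBs := hU.mono hB hBU
  have hperp := hU.perp hG.1 hAU hBU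
  have hjoin := hG.1.isSingularSubspace_join hAs hBs hperp
  have hsub : G.span (A ∪ B) ⊆ U := span_subset hU.1 (Set.union_subset hAU hBU)
  have h₁ : G.rank A < G.rank (G.span (A ∪ B)) := by
    refine hG.rank_lt hjoin hA (Set.subset_union_left.trans (subset_span _)) fun heq => hne ?_
    refine (hG.eq_of_subset_of_rank_le hAs hB ?_ (by omega)).symm
    rw [heq]
    exact Set.subset_union_right.trans (subset_span _)
  have h₂ := hG.rank_mono hU (isSubspace_span _) hsub
  have h₃ := hG.rank_join_add_rank_inter hAs hBs hperp
  exact ⟨by omega, hG.eq_of_subset_of_rank_le hU (isSubspace_span _) hsub (by omega)⟩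

end IsPolarSpaceOfRank

theorem Independent.notMem_span {X : Set P} (hX : G.Independent X) {p : P} (hp : p ∈ X) :
    p ∉ G.span (X \ {p}) := by
  intro h
  refine hX (X \ {p}) ⟨Set.sdiff_subset, fun hs => (hs hp).2 rfl⟩
    ((span_mono Set.sdiff_subset).antisymm (span_subset (isSubspace_span _) fun q hq => ?_))
  rcases eq_or_ne q p with rfl | hne
  exacts [h, subset_span _ ⟨hq, hne⟩]

theorem Independent.subset {X Y : Set P} (hX : G.Independent X) (hYX : Y ⊆ X) :
    G.Independent Y := by
  intro Z hZ heq
  obtain ⟨p, hpY, hpZ⟩ := Set.exists_of_ssubset hZ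
  refine hX.notMem_span (hYX hpY) (span_mono (X := Z) ?_ (heq ▸ subset_span Y hpY))
  intro q hq
  refine ⟨hYX (hZ.subset hq), ?_⟩
  rintro rfl
  exact hpZ hq

/-! ### Independent sets of points in the Grassmann space -/

namespace IsPolarSpaceOfRank

variable {n : ℕ} (hG : G.IsPolarSpaceOfRank n) {k : ℕ}
include hG

theorem rank_grassmannian (X : G.Grassmannian (k : ℤ)) : G.rank X.1 = k + 1 := by
  have := (hG.mem_grassmannian.1 X.2).2
  omega

/-- Membership in the span of two points of a line of the Grassmann space. -/
theorem mem_span_of_line {C : Set (G.Grassmannian (k : ℤ))} {Y₁ Y₂ Z : G.Grassmannian (k : ℤ)}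
    (h₁ : Y₁ ∈ (G.grassmannSpace k).span C) (h₂ : Y₂ ∈ (G.grassmannSpace k).span C)
    (hne : Y₁ ≠ Y₂) {S U : Set P} (hS : G.IsSubspace S) (hSr : G.rank S = k)
    (hU : G.IsSingularSubspace U) (hUr : G.rank U = k + 2)
    (hSY₁ : S ⊆ Y₁.1) (hSY₂ : S ⊆ Y₂.1) (hSZ : S ⊆ Z.1)
    (hY₁U : Y₁.1 ⊆ U) (hY₂U : Y₂.1 ⊆ U) (hZU : Z.1 ⊆ U) :
    Z ∈ (G.grassmannSpace k).span C := by
  have hSU := hSZ.trans hZU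
  refine isSubspace_span C Y₁ h₁ Y₂ h₂ hne (G.between S U k) ⟨S, ?_, U, ?_, hSU, rfl⟩
    ⟨hSY₁, hY₁U⟩ ⟨hSY₂, hY₂U⟩ ⟨hSZ, hZU⟩
  · exact hG.mem_grassmannian.2 ⟨hU.mono hS hSU, by omega⟩
  · exact hG.mem_grassmannian.2 ⟨hU, by omega⟩

theorem isSingularSubspace_starJoin {N : Set P} (hN : G.IsSingularSubspace N)
    {C : Finset (G.Grassmannian (k : ℤ))} (hNC : ∀ X ∈ C, N ⊆ X.1)
    (hC : ∀ X ∈ C, ∀ Y ∈ C, G.Perp X.1 Y.1) :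
    G.IsSingularSubspace (G.span (N ∪ ⋃ X ∈ C, X.1)) := by
  have hNX : ∀ X ∈ C, ∀ p ∈ N, ∀ q ∈ X.1, G.Collinear p q := fun X hX p hp q hq =>
    X.2.1.collinear hG.1 (hNC X hX hp) hq
  apply hG.1.isSingularSubspace_span
  simp only [Set.mem_union, Set.mem_iUnion, exists_prop]
  rintro p (hp | ⟨X, hX, hp⟩) q (hq | ⟨Y, hY, hq⟩)
  exacts [hN.collinear hG.1 hp hq, hNX Y hY p hp q hq, (hNX X hX q hq p hp).symm,
    hC X hX Y hY p hp q hq]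

omit hG in
theorem starJoin_insert [DecidableEq (G.Grassmannian (k : ℤ))] (N : Set P)
    (C : Finset (G.Grassmannian (k : ℤ))) (Y : G.Grassmannian (k : ℤ)) :
    G.span (N ∪ ⋃ X ∈ insert Y C, X.1) = G.span (G.span (N ∪ ⋃ X ∈ C, X.1) ∪ Y.1) := by
  have hY : Y.1 ⊆ ⋃ X ∈ insert Y C, X.1 := fun x hx => by simp [hx]
  have hC : (⋃ X ∈ C, X.1) ⊆ ⋃ X ∈ insert Y C, X.1 :=
    Set.biUnion_subset_biUnion_left fun X hX => Finset.mem_insert_of_mem hX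
  apply Set.Subset.antisymm
  · apply span_mono
    rw [Finset.set_biUnion_insert]
    refine Set.union_subset (Set.subset_union_left.trans ((subset_span _).trans
      Set.subset_union_left)) (Set.union_subset Set.subset_union_right ?_)
    exact Set.subset_union_right.trans ((subset_span _).trans Set.subset_union_left)
  · refine span_subset (isSubspace_span _) (Set.union_subset (span_mono ?_) ?_)
    · exact Set.union_subset_union_right _ hC
    · exact (hY.trans Set.subset_union_right).trans (subset_span _)

/-- Projective geometry over N: if Z lies neither in the join J of the earlier members nor equals Y,
the line of the Grassmann space through Y and Z contains W = ⟨Z, Y⟩ ∩ J. By induction W is already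
spanned, and Z is on the line through Y and W. -/
theorem mem_span_of_subset_starJoin {N : Set P} (hN : G.IsSingularSubspace N)
    (hNr : G.rank N = k) (C : Finset (G.Grassmannian (k : ℤ))) (hNC : ∀ X ∈ C, N ⊆ X.1)
    (hC : ∀ X ∈ C, ∀ Y ∈ C, G.Perp X.1 Y.1) (Z : G.Grassmannian (k : ℤ)) (hNZ : N ⊆ Z.1)
    (hZ : Z.1 ⊆ G.span (N ∪ ⋃ X ∈ C, X.1)) :
    Z ∈ (G.grassmannSpace k).span (C : Set (G.Grassmannian (k : ℤ))) := by
  classical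
  induction C using Finset.induction_on generalizing Z with
  | empty =>
    have hZN : Z.1 ⊆ N := by simpa [hN.1.span_eq] using hZ
    have := hG.rank_mono hN Z.2.1.1 hZN
    rw [hG.rank_grassmannian] at this
    omega
  | insert Y C hYC ih =>
    have hNC' : ∀ X ∈ C, N ⊆ X.1 := fun X hX => hNC X (Finset.mem_insert_of_mem hX)
    have hC' : ∀ X ∈ C, ∀ Y ∈ C, G.Perp X.1 Y.1 := fun X hX Y hY =>
      hC X (Finset.mem_insert_of_mem hX) Y (Finset.mem_insert_of_mem hY)
    have hJ := hG.isSingularSubspace_starJoin hN hNC' hC'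
    have hJ' := hG.isSingularSubspace_starJoin hN hNC hC
    have hNY := hNC Y (Finset.mem_insert_self _ _)
    specialize ih hNC' hC'
    rw [starJoin_insert] at hZ hJ'
    have hNJ : N ⊆ G.span (N ∪ ⋃ X ∈ C, X.1) := Set.subset_union_left.trans (subset_span _)
    set J := G.span (N ∪ ⋃ X ∈ C, X.1) with hJdef
    have hmono : (G.grassmannSpace k).span (C : Set (G.Grassmannian (k : ℤ))) ⊆
        (G.grassmannSpace k).span ((insert Y C : Finset _) : Set (G.Grassmannian (k : ℤ))) :=
      span_mono (by simp)
    have hYmem : Y ∈ (G.grassmannSpace k).span ((insert Y C : Finset _) :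
        Set (G.Grassmannian (k : ℤ))) := subset_span _ (by simp)
    by_cases hZJ : Z.1 ⊆ J
    · exact hmono (ih Z hNZ hZJ)
    have hYJ : ¬ Y.1 ⊆ J := fun hYJ => hZJ <| by
      rwa [Set.union_eq_left.2 hYJ, hJ.1.span_eq] at hZ
    rcases eq_or_ne Z Y with rfl | hZY
    · exact hYmem
    have hJJ' : J ⊆ G.span (J ∪ Y.1) := Set.subset_union_left.trans (subset_span _)
    have hYJ' : Y.1 ⊆ G.span (J ∪ Y.1) := Set.subset_union_right.trans (subset_span _)
    have hYr := hG.rank_grassmannian Y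
    have hZr := hG.rank_grassmannian Z
    have hZYperp := hJ'.perp hG.1 hZ hYJ'
    have hV := hG.1.isSingularSubspace_join Z.2.1 Y.2.1 hZYperp
    have hVJ' : G.span (Z.1 ∪ Y.1) ⊆ G.span (J ∪ Y.1) :=
      span_subset hJ'.1 (Set.union_subset hZ hYJ')
    have hZV : Z.1 ⊆ G.span (Z.1 ∪ Y.1) := Set.subset_union_left.trans (subset_span _)
    have hYV : Y.1 ⊆ G.span (Z.1 ∪ Y.1) := Set.subset_union_right.trans (subset_span _)
    have e₁ := hG.rank_join_add_rank_inter hJ Y.2.1 (hJ'.perp hG.1 hJJ' hYJ')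
    have e₂ := hG.rank_join_add_rank_inter Z.2.1 Y.2.1 hZYperp
    have e₃ := hG.rank_join_add_rank_inter hV hJ (hJ'.perp hG.1 hVJ' hJJ')
    have e₄ : G.span (G.span (Z.1 ∪ Y.1) ∪ J) = G.span (J ∪ Y.1) :=
      (span_subset hJ'.1 (Set.union_subset hVJ' hJJ')).antisymm (span_subset (isSubspace_span _)
        (Set.union_subset (Set.subset_union_right.trans (subset_span _))
          (hYV.trans (Set.subset_union_left.trans (subset_span _)))))
    have f₁ := hG.rank_mono (hJ.inter Y.2.1.1) hN.1 (Set.subset_inter hNJ hNY)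
    have f₂ := hG.rank_mono (Z.2.1.inter Y.2.1.1) hN.1 (Set.subset_inter hNZ hNY)
    have f₃ := hG.rank_lt Y.2.1 (hJ.1.inter Y.2.1.1) Set.inter_subset_right
      fun heq => hYJ (Set.inter_eq_right.1 heq)
    have f₄ : G.rank (Z.1 ∩ Y.1) < G.rank Z.1 := hG.rank_lt Z.2.1 (Z.2.1.1.inter Y.2.1.1)
      Set.inter_subset_left fun heq => hZY <| Subtype.ext <| hG.eq_of_subset_of_rank_le Y.2.1
        Z.2.1.1 (Set.inter_eq_left.1 heq) (by omega)
    rw [e₄] at e₃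
    have hW := hV.inter hJ.1
    let W : G.Grassmannian (k : ℤ) :=
      ⟨G.span (Z.1 ∪ Y.1) ∩ J, hG.mem_grassmannian.2 ⟨hW, by omega⟩⟩
    have hNW : N ⊆ W.1 := Set.subset_inter (hNZ.trans hZV) hNJ
    have hWmem := hmono (ih W hNW Set.inter_subset_right)
    refine hG.mem_span_of_line hYmem hWmem ?_ hN.1 hNr hV (by omega) hNY hNW hNZ hYV
      Set.inter_subset_left hZV
    intro heq
    apply hYJ
    rw [heq]
    exact Set.inter_subset_right

/-- An independent clique in a star spans a singular subspace of the expected dimension. -/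
theorem rank_starJoin {N : Set P} (hN : G.IsSingularSubspace N)
    (hNr : G.rank N = k) (C : Finset (G.Grassmannian (k : ℤ))) (hNC : ∀ X ∈ C, N ⊆ X.1)
    (hC : ∀ X ∈ C, ∀ Y ∈ C, G.Perp X.1 Y.1)
    (hind : (G.grassmannSpace k).Independent (C : Set (G.Grassmannian (k : ℤ)))) :
    G.rank (G.span (N ∪ ⋃ X ∈ C, X.1)) = k + C.card := by
  classical
  induction C using Finset.induction_on with
  | empty => simp [hN.1.span_eq, hNr]
  | insert Y C hYC ih =>
    have hNC' : ∀ X ∈ C, N ⊆ X.1 := fun X hX => hNC X (Finset.mem_insert_of_mem hX)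
    have hC' : ∀ X ∈ C, ∀ Y ∈ C, G.Perp X.1 Y.1 := fun X hX Y hY =>
      hC X (Finset.mem_insert_of_mem hX) Y (Finset.mem_insert_of_mem hY)
    have hJ := hG.isSingularSubspace_starJoin hN hNC' hC'
    have hJ' := hG.isSingularSubspace_starJoin hN hNC hC
    have hNY := hNC Y (Finset.mem_insert_self _ _)
    specialize ih hNC' hC' (hind.subset (by simp))
    have hnot : ¬ Y.1 ⊆ G.span (N ∪ ⋃ X ∈ C, X.1) := fun hY => by
      refine hind.notMem_span (p := Y) (by simp) (span_mono ?_
        (hG.mem_span_of_subset_starJoin hN hNr C hNC' hC' Y hNY hY))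
      intro X hX
      refine ⟨by simpa using Or.inr hX, ?_⟩
      rintro rfl
      exact hYC hX
    rw [starJoin_insert] at hJ' ⊢
    have e₁ := hG.rank_join_add_rank_inter hJ Y.2.1 (hJ'.perp hG.1
      (Set.subset_union_left.trans (subset_span _)) (Set.subset_union_right.trans (subset_span _)))
    have f₁ := hG.rank_mono (hJ.inter Y.2.1.1) hN.1
      (Set.subset_inter (Set.subset_union_left.trans (subset_span _)) hNY)
    have f₃ := hG.rank_lt Y.2.1 (hJ.1.inter Y.2.1.1) Set.inter_subset_right
      fun heq => hnot (Set.inter_eq_right.1 heq)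
    have hYr := hG.rank_grassmannian Y
    rw [Finset.card_insert_of_notMem hYC]
    omega

/-- The dual of `mem_span_of_subset_starJoin`, for hyperplanes of U. With D the intersection of U
and the earlier members, W = ⟨D, Z ∩ Y⟩ is a hyperplane containing D, so it is spanned by induction,
and Z lies on the line [Z ∩ Y, U] through Y and W. -/
theorem mem_span_of_inter_subset {U : Set P} (hU : G.IsSingularSubspace U)
    (hUr : G.rank U = k + 2) (C : Finset (G.Grassmannian (k : ℤ))) (hCU : ∀ X ∈ C, X.1 ⊆ U)
    (Z : G.Grassmannian (k : ℤ)) (hZU : Z.1 ⊆ U) (hZ : U ∩ ⋂ X ∈ C, X.1 ⊆ Z.1) :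
    Z ∈ (G.grassmannSpace k).span (C : Set (G.Grassmannian (k : ℤ))) := by
  classical
  induction C using Finset.induction_on generalizing Z with
  | empty =>
    have hUZ : U ⊆ Z.1 := by simpa using hZ
    have := hG.rank_mono Z.2.1 hU.1 hUZ
    rw [hG.rank_grassmannian] at this
    omega
  | insert Y C hYC ih =>
    specialize ih fun X hX => hCU X (Finset.mem_insert_of_mem hX)
    have hYU := hCU Y (Finset.mem_insert_self _ _)
    have hmono : (G.grassmannSpace k).span (C : Set (G.Grassmannian (k : ℤ))) ⊆
        (G.grassmannSpace k).span ((insert Y C : Finset _) : Set (G.Grassmannian (k : ℤ))) :=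
      span_mono (by simp)
    have hYmem : Y ∈ (G.grassmannSpace k).span ((insert Y C : Finset _) :
        Set (G.Grassmannian (k : ℤ))) := subset_span _ (by simp)
    set D := U ∩ ⋂ X ∈ C, X.1 with hD
    have hDs : G.IsSubspace D := by
      exact hU.1.inter (isSubspace_iInter fun X => isSubspace_iInter fun _ => X.2.1.1)
    have hDY : D ∩ Y.1 ⊆ Z.1 := by
      refine subset_trans ?_ hZ
      rw [Finset.set_biInter_insert]
      exact fun x hx => ⟨hx.1.1, hx.2, hx.1.2⟩
    by_cases hDZ : D ⊆ Z.1
    · exact hmono (ih Z hZU hDZ)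
    have hDnY : ¬ D ⊆ Y.1 := fun hDY' => hDZ ((Set.subset_inter subset_rfl hDY').trans hDY)
    rcases eq_or_ne Z Y with rfl | hZY
    · exact hYmem
    have hDU : D ⊆ U := Set.inter_subset_left
    have hYr := hG.rank_grassmannian Y
    have hZr := hG.rank_grassmannian Z
    obtain ⟨hSr, -⟩ := hG.rank_inter_of_hyperplanes hU Z.2.1.1 Y.2.1.1 hZU hYU hUr hZr hYr
      fun heq => hZY (Subtype.ext heq)
    have hS := Z.2.1.inter Y.2.1.1
    have hDsing := hU.mono hDs hDU
    have hSU : Z.1 ∩ Y.1 ⊆ U := Set.inter_subset_left.trans hZU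
    have hDS : D ∩ (Z.1 ∩ Y.1) = D ∩ Y.1 := by
      ext x
      exact ⟨fun hx => ⟨hx.1, hx.2.2⟩, fun hx => ⟨hx.1, hDY hx, hx.2⟩⟩
    have e₁ := hG.rank_join_add_rank_inter hDsing Y.2.1 (hU.perp hG.1 hDU hYU)
    have e₂ := hG.rank_join_add_rank_inter hDsing hS (hU.perp hG.1 hDU hSU)
    have hDYU : G.span (D ∪ Y.1) ⊆ U := span_subset hU.1 (Set.union_subset hDU hYU)
    have f₁ := hG.rank_mono hU (isSubspace_span _) hDYU
    have f₂ : G.rank Y.1 < G.rank (G.span (D ∪ Y.1)) :=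
      hG.rank_lt (hU.mono (isSubspace_span _) hDYU) Y.2.1.1
        (Set.subset_union_right.trans (subset_span _)) fun heq => hDnY <| by
          rw [heq]
          exact Set.subset_union_left.trans (subset_span _)
    rw [hDS] at e₂
    have hDSU : G.span (D ∪ Z.1 ∩ Y.1) ⊆ U := span_subset hU.1 (Set.union_subset hDU hSU)
    let W : G.Grassmannian (k : ℤ) := ⟨G.span (D ∪ Z.1 ∩ Y.1),
      hG.mem_grassmannian.2 ⟨hU.mono (isSubspace_span _) hDSU, by omega⟩⟩
    have hDW : D ⊆ W.1 := Set.subset_union_left.trans (subset_span _)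
    have hWmem := hmono (ih W hDSU hDW)
    refine hG.mem_span_of_line hYmem hWmem ?_ hS.1 (by omega) hU hUr Set.inter_subset_right
      (Set.subset_union_right.trans (subset_span _)) Set.inter_subset_left hYU hDSU hZU
    intro heq
    exact hDnY (heq ▸ hDW)

end IsPolarSpaceOfRank

end PointLineGeometry

/-! ### Combinatorics of singular subsets -/

section SingularSubsets

variable {l : ℕ}

theorem IsSingularSubset.mono {X Y : Finset (Fin l × Bool)} (hY : IsSingularSubset Y)
    (h : X ⊆ Y) : IsSingularSubset X := fun i b hX hX' => hY i b (h hX) (h hX')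

theorem isSingularSubset_empty : IsSingularSubset (∅ : Finset (Fin l × Bool)) :=
  fun i b h => by simp at h

theorem IsSingularSubset.insert {X : Finset (Fin l × Bool)} (hX : IsSingularSubset X)
    {x : Fin l × Bool} (hx : (x.1, !x.2) ∉ X) : IsSingularSubset (insert x X) := by
  intro i b h₁ h₂
  rcases Finset.mem_insert.1 h₁ with rfl | h₁ <;> rcases Finset.mem_insert.1 h₂ with h₂ | h₂
  · simpa using congrArg Prod.snd h₂
  · exact hx h₂
  · subst h₂
    exact hx (by simpa using h₁)
  · exact hX i b h₁ h₂

theorem IsSingularSubset.notMem_of_insert {X : Finset (Fin l × Bool)} {x : Fin l × Bool}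
    (hX : IsSingularSubset (Insert.insert x X)) : (x.1, !x.2) ∉ X := fun h =>
  hX x.1 x.2 (Finset.mem_insert_self _ _) (Finset.mem_insert_of_mem h)

theorem IsSingularSubset.exists_insert_isSingularSubset {X : Finset (Fin l × Bool)}
    (hX : IsSingularSubset X) (hc : X.card < l) :
    ∃ x, x ∉ X ∧ IsSingularSubset (Insert.insert x X) := by
  obtain ⟨i, hi⟩ : ∃ i, ∀ b, (i, b) ∉ X := by
    by_contra H
    push Not at H
    choose b hb using H
    have := Finset.card_le_card_of_injOn (s := Finset.univ) (t := X) (fun i => (i, b i))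
      (fun i _ => hb i) (fun i _ j _ hij => congrArg Prod.fst hij)
    simp at this
    omega
  exact ⟨(i, true), hi _, hX.insert (hi _)⟩

theorem IsSingularSubset.exists_superset {X : Finset (Fin l × Bool)} (hX : IsSingularSubset X)
    {c : ℕ} (hc : X.card ≤ c) (hcl : c ≤ l) :
    ∃ Y, X ⊆ Y ∧ IsSingularSubset Y ∧ Y.card = c := by
  induction c, hc using Nat.le_induction with
  | base => exact ⟨X, subset_rfl, hX, rfl⟩
  | succ c hc ih =>
    obtain ⟨Y, hXY, hY, rfl⟩ := ih (by omega)
    obtain ⟨y, hyY, hy⟩ := hY.exists_insert_isSingularSubset (by omega)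
    exact ⟨_, hXY.trans (Finset.subset_insert y Y), hy, Finset.card_insert_of_notMem hyY⟩

/-- Any two singular subsets of the same size are connected by replacing single elements. -/
theorem IsSingularSubset.induction_exchange {c : ℕ} {p : Finset (Fin l × Bool) → Prop}
    (step : ∀ Y, IsSingularSubset Y → Y.card = c → p Y → ∀ t ∈ Y, ∀ s ∉ Y,
      IsSingularSubset (Insert.insert s (Y.erase t)) → p (Insert.insert s (Y.erase t)))
    {Y X : Finset (Fin l × Bool)} (hY : IsSingularSubset Y) (hYc : Y.card = c) (hp : p Y)
    (hX : IsSingularSubset X) (hXc : X.card = c) : p X := by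
  induction hd : (X \ Y).card using Nat.strong_induction_on generalizing Y with
  | _ d ih =>
  rcases (X \ Y).eq_empty_or_nonempty with he | ⟨s, hs⟩
  · rwa [Finset.eq_of_subset_of_card_le (Finset.sdiff_eq_empty_iff_subset.1 he) (by omega)]
  obtain ⟨hsX, hsY⟩ := Finset.mem_sdiff.1 hs
  -- The element to be removed must be the opposite of s if that is in Y; otherwise any element of Y
  -- \ X will do.
  obtain ⟨t, htY, htX, ht⟩ : ∃ t ∈ Y, t ∉ X ∧ (s.1, !s.2) ∉ Y.erase t := by
    by_cases hsY' : (s.1, !s.2) ∈ Y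
    · exact ⟨_, hsY', hX s.1 s.2 hsX, by simp⟩
    · obtain ⟨t, htY, htX⟩ := Finset.not_subset.1 fun hYX : Y ⊆ X =>
        hsY (Finset.eq_of_subset_of_card_le hYX (by omega) ▸ hsX)
      exact ⟨t, htY, htX, fun h => hsY' (Finset.mem_of_mem_erase h)⟩
  have hY' := (hY.mono (Y.erase_subset t)).insert ht
  have hc' : (Insert.insert s (Y.erase t)).card = c := by
    rw [Finset.card_insert_of_notMem fun h => hsY (Finset.mem_of_mem_erase h),
      Finset.card_erase_of_mem htY]
    have := Finset.card_pos.2 ⟨t, htY⟩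
    omega
  refine ih _ ?_ hY' hc' (step Y hY hYc hp t htY s hsY hY') rfl
  rw [← hd]
  refine Finset.card_lt_card ⟨fun q hq => ?_, fun h => ?_⟩
  · rw [Finset.mem_sdiff, Finset.mem_insert, Finset.mem_erase] at hq
    refine Finset.mem_sdiff.2 ⟨hq.1, fun hqY => hq.2 (Or.inr ⟨?_, hqY⟩)⟩
    rintro rfl
    exact htX hq.1
  · exact (Finset.mem_sdiff.1 (h hs)).2 (Finset.mem_insert_self _ _)

end SingularSubsets

/-! ### Descent along families that keep stars and tops -/

namespace PointLineGeometry

variable {P : Type*} {G : PointLineGeometry P}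

/-- Of three pairwise adjacent subspaces, the third one contains the intersection of the first two
or is contained in their join. -/
theorem IsPolarSpaceOfRank.subset_join_of_not_inter_subset {n r : ℕ}
    (hG : G.IsPolarSpaceOfRank n) {X Y Z : Set P} (hX : G.IsSingularSubspace X)
    (hY : G.IsSingularSubspace Y) (hZ : G.IsSingularSubspace Z)
    (hXY : G.rank (X ∩ Y) + 1 = r) (hZX : G.rank (Z ∩ X) + 1 = r) (hZY : G.rank (Z ∩ Y) + 1 = r)
    (hZr : G.rank Z = r) (hnot : ¬ X ∩ Y ⊆ Z) : Z ⊆ G.span (X ∪ Y) := by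
  have hne : Z ∩ X ≠ Z ∩ Y := fun heq => hnot <| by
    have hsub : Z ∩ X ⊆ X ∩ Y := fun x hx => ⟨hx.2, (heq ▸ hx : x ∈ Z ∩ Y).2⟩
    rw [← hG.eq_of_subset_of_rank_le (hX.inter hY.1) (hZ.1.inter hX.1) hsub (by omega)]
    exact Set.inter_subset_left
  obtain ⟨-, h⟩ := hG.rank_inter_of_hyperplanes (r := G.rank (Z ∩ X)) hZ (hZ.1.inter hX.1)
    (hZ.1.inter hY.1) Set.inter_subset_left Set.inter_subset_left (by omega) rfl (by omega) hne
  calc Z = _ := h.symm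
    _ ⊆ _ := span_mono (Set.union_subset_union Set.inter_subset_right Set.inter_subset_right)

/-- A family of subspaces of rank `r` indexed by the singular subsets with `s` elements, in which
tops are independent sets of hyperplanes of a subspace. -/
structure IsTopFamily (G : PointLineGeometry P) {l : ℕ} (s r : ℕ)
    (f : Finset (Fin l × Bool) → Set P) : Prop where
  isSingularSubspace : ∀ X, IsSingularSubset X → X.card = s → G.IsSingularSubspace (f X)
  rank_eq : ∀ X, IsSingularSubset X → X.card = s → G.rank (f X) = r
  top : ∀ Y, IsSingularSubset Y → Y.card = s + 1 →
    ∃ U, G.IsSingularSubspace U ∧ G.rank U = r + 1 ∧ ∀ y ∈ Y, f (Y.erase y) ⊆ U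
  indep : ∀ Y, IsSingularSubset Y → Y.card = s + 1 → ∀ y ∈ Y,
    ∃ p, p ∉ f (Y.erase y) ∧ ∀ y' ∈ Y, y' ≠ y → p ∈ f (Y.erase y')

/-- Of three elements `A ∪ {x}`, `A ∪ {y}`, `A ∪ {z}` of a star with `s` elements each, the third
one is mapped to a set containing the intersection of the images of the first two. -/
def PreservesStars {l : ℕ} (s : ℕ) (f : Finset (Fin l × Bool) → Set P) : Prop :=
  ∀ A x y z, x ∉ A → y ∉ A → z ∉ A → x ≠ y → x ≠ z → y ≠ z → A.card + 1 = s →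
    IsSingularSubset (insert x (insert y (insert z A))) →
    f (insert x A) ∩ f (insert y A) ⊆ f (insert z A)

/-- `PreservesStars` requires x, y, z to be jointly compatible, while here z may be opposite to x or
y. A further index w, available since A has at most l - 3 elements, then replaces the one opposite
to z. -/
theorem PreservesStars.inter_subset {l s : ℕ} {f : Finset (Fin l × Bool) → Set P}
    (hst : PreservesStars s f) {A : Finset (Fin l × Bool)} (hAs : A.card + 1 = s)
    (hAl : A.card + 3 ≤ l) {x y z : Fin l × Bool} (hxA : x ∉ A) (hyA : y ∉ A) (hzA : z ∉ A)
    (hxy : x ≠ y) (hs : IsSingularSubset (insert x (insert y A)))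
    (hz : IsSingularSubset (insert z A)) : f (insert x A) ∩ f (insert y A) ⊆ f (insert z A) := by
  have hz' := hz.notMem_of_insert
  have key : ∀ u v, u ∉ A → v ∉ A → u ≠ v → IsSingularSubset (insert u (insert v A)) →
      u ≠ (z.1, !z.2) → v ≠ (z.1, !z.2) →
      f (insert u A) ∩ f (insert v A) ⊆ f (insert z A) := by
    intro u v hu hv huv hs huz hvz
    rcases eq_or_ne u z with rfl | huz'
    · exact Set.inter_subset_left
    rcases eq_or_ne v z with rfl | hvz'
    · exact Set.inter_subset_right
    refine hst A u v z hu hv hzA huv huz' hvz' hAs ?_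
    rw [Finset.insert_comm v z, Finset.insert_comm u z]
    refine hs.insert ?_
    simp only [Finset.mem_insert, not_or]
    exact ⟨huz.symm, hvz.symm, hz'⟩
  have hc₁ := Finset.card_insert_of_notMem hyA
  have hc₂ := Finset.card_insert_of_notMem (s := insert y A) (a := x) (by simp [hxy, hxA])
  obtain ⟨w, hwA, hw⟩ := hs.exists_insert_isSingularSubset (by omega)
  simp only [Finset.mem_insert, not_or] at hwA
  obtain ⟨hwx, hwy, hwA⟩ := hwA
  have hCw : f (insert x A) ∩ f (insert y A) ⊆ f (insert w A) :=
    hst A x y w hxA hyA hwA hxy (Ne.symm hwx) (Ne.symm hwy) hAs <| by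
      rwa [Finset.insert_comm y w, Finset.insert_comm x w]
  by_cases h₁ : x = (z.1, !z.2)
  · refine (Set.subset_inter hCw Set.inter_subset_right).trans
      (key w y hwA hyA hwy (hw.mono ?_) ?_ ?_)
    · exact Finset.insert_subset_insert _ (Finset.subset_insert _ _)
    · exact fun h => hwx (h.trans h₁.symm)
    · exact fun h => hxy (h₁.trans h.symm)
  by_cases h₂ : y = (z.1, !z.2)
  · refine (Set.subset_inter hCw Set.inter_subset_left).trans
      (key w x hwA hxA hwx (hw.mono ?_) ?_ h₁)
    · exact Finset.insert_subset_insert _ (Finset.insert_subset_insert _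
        (Finset.subset_insert _ _))
    · exact fun h => hwy (h.trans h₂.symm)
  exact key x y hxA hyA hxy hs h₁ h₂

namespace IsTopFamily

variable {n l s r : ℕ} {f : Finset (Fin l × Bool) → Set P}

theorem rank_inter_and_join (hf : G.IsTopFamily s r f) (hG : G.IsPolarSpaceOfRank n)
    {Y : Finset (Fin l × Bool)} (hY : IsSingularSubset Y) (hYs : Y.card = s + 1)
    {x y : Fin l × Bool} (hx : x ∈ Y) (hy : y ∈ Y) (hxy : x ≠ y) :
    f (Y.erase x) ≠ f (Y.erase y) ∧ G.Perp (f (Y.erase x)) (f (Y.erase y)) ∧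
      G.rank (f (Y.erase x) ∩ f (Y.erase y)) + 1 = r ∧
      G.rank (G.span (f (Y.erase x) ∪ f (Y.erase y))) = r + 1 := by
  obtain ⟨U, hU, hUr, hYU⟩ := hf.top Y hY hYs
  obtain ⟨p, hpx, hp⟩ := hf.indep Y hY hYs x hx
  have hne : f (Y.erase x) ≠ f (Y.erase y) := fun heq => hpx (heq ▸ hp y hy hxy.symm)
  have hX := hY.mono (Y.erase_subset x)
  have hX' := hY.mono (Y.erase_subset y)
  have hXs : (Y.erase x).card = s := by
    rw [Finset.card_erase_of_mem hx, hYs, Nat.add_sub_cancel]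
  have hXs' : (Y.erase y).card = s := by
    rw [Finset.card_erase_of_mem hy, hYs, Nat.add_sub_cancel]
  obtain ⟨h₁, h₂⟩ := hG.rank_inter_of_hyperplanes hU (hf.isSingularSubspace _ hX hXs).1
    (hf.isSingularSubspace _ hX' hXs').1 (hYU x hx) (hYU y hy) hUr (hf.rank_eq _ hX hXs)
    (hf.rank_eq _ hX' hXs') hne
  exact ⟨hne, hU.perp hG.1 (hYU x hx) (hYU y hy), h₁, h₂ ▸ hUr⟩

theorem rank_insert_inter_and_join (hf : G.IsTopFamily s r f)
    (hG : G.IsPolarSpaceOfRank n) {A : Finset (Fin l × Bool)} (hA : A.card + 1 = s)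
    {x y : Fin l × Bool} (hxA : x ∉ A) (hyA : y ∉ A) (hxy : x ≠ y)
    (hY : IsSingularSubset (insert x (insert y A))) :
    f (insert x A) ≠ f (insert y A) ∧ G.Perp (f (insert x A)) (f (insert y A)) ∧
      G.rank (f (insert x A) ∩ f (insert y A)) + 1 = r ∧
      G.rank (G.span (f (insert x A) ∪ f (insert y A))) = r + 1 := by
  have hx : x ∉ insert y A := by simp [hxy, hxA]
  have hy : y ∉ insert x A := by simp [hxy.symm, hyA]
  have := hf.rank_inter_and_join hG hY (x := y) (y := x)
    (by rw [Finset.card_insert_of_notMem hx, Finset.card_insert_of_notMem hyA, hA])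
    (by simp) (by simp) hxy.symm
  rwa [Finset.erase_insert hx, Finset.insert_comm, Finset.erase_insert hy] at this

/-- The intersection of one compatible pair lies in every member of the star, and all such
intersections have the same rank, so they coincide. -/
theorem exists_center (hf : G.IsTopFamily s r f) (hst : PreservesStars s f)
    (hG : G.IsPolarSpaceOfRank n)
    {A : Finset (Fin l × Bool)} (hA : IsSingularSubset A) (hAs : A.card + 1 = s)
    (hAl : A.card + 3 ≤ l) :
    ∃ C, G.IsSingularSubspace C ∧ G.rank C + 1 = r ∧
      (∀ x ∉ A, IsSingularSubset (insert x A) → C ⊆ f (insert x A)) ∧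
      ∀ x ∉ A, ∀ y ∉ A, x ≠ y → IsSingularSubset (insert x (insert y A)) →
        f (insert x A) ∩ f (insert y A) = C := by
  obtain ⟨x, hxA, hx⟩ := hA.exists_insert_isSingularSubset (by omega)
  have hc₁ := Finset.card_insert_of_notMem hxA
  obtain ⟨y, hyA, hy⟩ := hx.exists_insert_isSingularSubset (by omega)
  simp only [Finset.mem_insert, not_or] at hyA
  obtain ⟨hyx, hyA⟩ := hyA
  have single : ∀ {u v : Fin l × Bool}, IsSingularSubset (insert u (insert v A)) →
      IsSingularSubset (insert u A) := fun h =>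
    h.mono (Finset.insert_subset_insert _ (Finset.subset_insert _ _))
  have hr₁ := (hf.rank_insert_inter_and_join hG hAs hyA hxA hyx hy).2.2.1
  have hC := (hf.isSingularSubspace _ (single hy)
    (by rw [Finset.card_insert_of_notMem hyA, hAs])).inter
    (hf.isSingularSubspace _ hx (by rw [hc₁, hAs])).1
  have hsub : ∀ z ∉ A, IsSingularSubset (insert z A) →
      f (insert y A) ∩ f (insert x A) ⊆ f (insert z A) := fun z hzA hz =>
    hst.inter_subset hAs hAl hyA hxA hzA hyx hy hz
  refine ⟨_, hC, hr₁, hsub, fun u hu v hv huv huv' => ?_⟩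
  have hu' := single huv'
  have hv' : IsSingularSubset (insert v A) := huv'.mono (Finset.subset_insert _ _)
  refine (hG.eq_of_subset_of_rank_le ((hf.isSingularSubspace _ hu' ?_).inter
    (hf.isSingularSubspace _ hv' ?_).1) hC.1 (Set.subset_inter (hsub u hu hu') (hsub v hv hv'))
    ?_).symm
  · rw [Finset.card_insert_of_notMem hu, hAs]
  · rw [Finset.card_insert_of_notMem hv, hAs]
  · have := (hf.rank_insert_inter_and_join hG hAs hu hv huv huv').2.2.1
    omega

/-- The centers of the stars of a family form a family indexed by smaller subsets. -/
theorem descend (hf : G.IsTopFamily (s + 1) (r + 1) f) (hst : PreservesStars (s + 1) f)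
    (hG : G.IsPolarSpaceOfRank n) (hsl : s + 3 ≤ l) :
    ∃ g : Finset (Fin l × Bool) → Set P, G.IsTopFamily s r g ∧ PreservesStars s g ∧
      ∀ Y, IsSingularSubset Y → Y.card = s + 1 → ∀ y ∈ Y, g (Y.erase y) ⊆ f Y := by
  have hC : ∀ A : Finset (Fin l × Bool), ∃ C, IsSingularSubset A → A.card = s →
      G.IsSingularSubspace C ∧ G.rank C + 1 = r + 1 ∧
      (∀ x ∉ A, IsSingularSubset (insert x A) → C ⊆ f (insert x A)) ∧
      ∀ x ∉ A, ∀ y ∉ A, x ≠ y → IsSingularSubset (insert x (insert y A)) →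
        f (insert x A) ∩ f (insert y A) = C := by
    intro A
    by_cases h : IsSingularSubset A ∧ A.card = s
    · obtain ⟨C, hC⟩ := hf.exists_center hst hG h.1 (by omega) (by omega)
      exact ⟨C, fun _ _ => hC⟩
    · exact ⟨∅, fun h₁ h₂ => absurd ⟨h₁, h₂⟩ h⟩
  choose g hg using hC
  have herase : ∀ {Y : Finset (Fin l × Bool)}, IsSingularSubset Y → Y.card = s + 1 → ∀ y ∈ Y,
      IsSingularSubset (Y.erase y) ∧ (Y.erase y).card = s := fun hY hYs y hy =>
    ⟨hY.mono (Finset.erase_subset _ _), by rw [Finset.card_erase_of_mem hy, hYs]; simp⟩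
  have hgf : ∀ Y, IsSingularSubset Y → Y.card = s + 1 → ∀ y ∈ Y, g (Y.erase y) ⊆ f Y := by
    intro Y hY hYs y hy
    obtain ⟨h₁, h₂⟩ := herase hY hYs y hy
    have := (hg _ h₁ h₂).2.2.1 y (by simp) (by rwa [Finset.insert_erase hy])
    rwa [Finset.insert_erase hy] at this
  have htop : ∀ Y, IsSingularSubset Y → Y.card = s + 1 → ∃ U, G.IsSingularSubspace U ∧
      G.rank U = r + 1 ∧ ∀ y ∈ Y, g (Y.erase y) ⊆ U := fun Y hY hYs =>
    -- The old subspace f Y serves as the carrier of the new top indexed by Y.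
    ⟨f Y, hf.isSingularSubspace Y hY hYs, hf.rank_eq Y hY hYs, hgf Y hY hYs⟩
  have hindep : ∀ Y, IsSingularSubset Y → Y.card = s + 1 → ∀ y ∈ Y,
      ∃ p, p ∉ g (Y.erase y) ∧ ∀ y' ∈ Y, y' ≠ y → p ∈ g (Y.erase y') := by
    intro Y hY hYs y hy
    obtain ⟨c, hcY, hc⟩ := hY.exists_insert_isSingularSubset (by omega)
    have hcne : ∀ z ∈ Y, c ≠ z := fun z hz hcz => hcY (hcz ▸ hz)
    have hcc := Finset.card_insert_of_notMem hcY
    -- The point witnessing independence of the larger top Y ∪ {c} also works here: p avoids a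
    -- subspace containing g (Y \ {y}), while g (Y \ {y'}) is the intersection of two members of
    -- that top, both containing p.
    obtain ⟨p, hpy, hp⟩ := hf.indep _ hc (by omega) y (by simp [hy])
    refine ⟨p, fun hpg => hpy ?_, fun y' hy' hne => ?_⟩
    · obtain ⟨h₁, h₂⟩ := herase hY hYs y hy
      rw [Finset.erase_insert_of_ne (hcne y hy)]
      refine (hg _ h₁ h₂).2.2.1 c (by simp [hcY]) (hc.mono ?_) hpg
      exact Finset.insert_subset_insert _ (Finset.erase_subset _ _)
    · obtain ⟨h₁, h₂⟩ := herase hY hYs y' hy'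
      have hcomm : insert c (insert y' (Y.erase y')) = insert c Y := by
        rw [Finset.insert_erase hy']
      rw [← (hg _ h₁ h₂).2.2.2 c (by simp [hcY]) y' (by simp) (hcne y' hy') (hcomm ▸ hc)]
      refine ⟨?_, ?_⟩
      · have := hp y' (by simp [hy']) hne
        rwa [Finset.erase_insert_of_ne (hcne y' hy')] at this
      · have := hp c (by simp) (hcne y hy)
        rwa [Finset.erase_insert hcY, ← Finset.insert_erase hy'] at this
  have hsing : ∀ X, IsSingularSubset X → X.card = s → G.IsSingularSubspace (g X) :=
    fun X hX hXs => (hg X hX hXs).1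
  have hrank : ∀ X, IsSingularSubset X → X.card = s → G.rank (g X) = r :=
    fun X hX hXs => by simpa using (hg X hX hXs).2.1
  have hgt : G.IsTopFamily s r g := ⟨hsing, hrank, htop, hindep⟩
  refine ⟨g, hgt, ?_, hgf⟩
  intro B x y z hxB hyB hzB hxy hxz hyz hBs hs
  by_contra hnot
  have hs₁ : ∀ {u v}, u ∉ B → v ∉ B → u ≠ v →
      insert u (insert v B) ⊆ insert x (insert y (insert z B)) →
      IsSingularSubset (insert u (insert v B)) ∧ (insert u (insert v B)).card = s + 1 :=
    fun hu hv huv hsub => ⟨hs.mono hsub, by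
      rw [Finset.card_insert_of_notMem (by simp [huv, hu]), Finset.card_insert_of_notMem hv, hBs]⟩
  have hs₂ : ∀ {u}, u ∉ B → insert u B ⊆ insert x (insert y (insert z B)) →
      IsSingularSubset (insert u B) ∧ (insert u B).card = s := fun hu hsub =>
    ⟨hs.mono hsub, by rw [Finset.card_insert_of_notMem hu, hBs]⟩
  have hsubf : ∀ {u v}, u ∉ B → v ∉ B → u ≠ v → IsSingularSubset (insert u (insert v B)) ∧
      (insert u (insert v B)).card = s + 1 → g (insert v B) ⊆ f (insert u (insert v B)) := by
    intro u v hu hv huv h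
    have := hgf _ h.1 h.2 u (by simp)
    rwa [Finset.erase_insert (by simp [huv, hu])] at this
  have sub : ∀ {u v}, (u = x ∨ u = y ∨ u = z) → (v = x ∨ v = y ∨ v = z) →
      insert u (insert v B) ⊆ insert x (insert y (insert z B)) := by
    intro u v hu hv t
    simp only [Finset.mem_insert]
    rintro (rfl | rfl | h)
    · tauto
    · tauto
    · tauto
  have sub' : ∀ {u}, (u = x ∨ u = y ∨ u = z) →
      insert u B ⊆ insert x (insert y (insert z B)) := fun hu =>
    (Finset.subset_insert _ _).trans (sub hu hu)
  have hxy' := hs₁ hxB hyB hxy (sub (by simp) (by simp))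
  have hyx' := hs₁ hyB hxB hxy.symm (sub (by simp) (by simp))
  have hxz' := hs₁ hxB hzB hxz (sub (by simp) (by simp))
  have hzx' := hs₁ hzB hxB hxz.symm (sub (by simp) (by simp))
  have hzy' := hs₁ hzB hyB hyz.symm (sub (by simp) (by simp))
  have hx' := hs₂ hxB (sub' (by simp))
  have hy' := hs₂ hyB (sub' (by simp))
  have hz' := hs₂ hzB (sub' (by simp))
  have jxy := hgt.rank_insert_inter_and_join hG hBs hxB hyB hxy hxy'.1
  have jzx := hgt.rank_insert_inter_and_join hG hBs hzB hxB hxz.symm hzx'.1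
  have jzy := hgt.rank_insert_inter_and_join hG hBs hzB hyB hyz.symm hzy'.1
  -- If the star property failed for g, then g (B ∪ {z}) would lie in f (B ∪ {x, y}). Both f (B ∪
  -- {x, y}) and f (B ∪ {x, z}) would then be spanned by g (B ∪ {x}) and g (B ∪ {z}), yet they are
  -- distinct.
  have hz := hG.subset_join_of_not_inter_subset (hsing _ hx'.1 hx'.2) (hsing _ hy'.1 hy'.2)
    (hsing _ hz'.1 hz'.2) jxy.2.2.1 jzx.2.2.1 jzy.2.2.1 (hrank _ hz'.1 hz'.2) hnot
  have hfxy := hf.isSingularSubspace _ hyx'.1 hyx'.2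
  have hfzx := hf.isSingularSubspace _ hzx'.1 hzx'.2
  have hgx₁ : g (insert x B) ⊆ f (insert y (insert x B)) := hsubf hyB hxB hxy.symm hyx'
  have hgy₁ : g (insert y B) ⊆ f (insert y (insert x B)) := by
    rw [Finset.insert_comm]
    exact hsubf hxB hyB hxy hxy'
  have hgx₂ : g (insert x B) ⊆ f (insert z (insert x B)) := hsubf hzB hxB hxz.symm hzx'
  have hgz₂ : g (insert z B) ⊆ f (insert z (insert x B)) := by
    rw [Finset.insert_comm]
    exact hsubf hxB hzB hxz hxz'
  have hgz₁ : g (insert z B) ⊆ f (insert y (insert x B)) :=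
    hz.trans (span_subset hfxy.1 (Set.union_subset hgx₁ hgy₁))
  have hr₁ := hf.rank_eq _ hyx'.1 hyx'.2
  have hr₂ := hf.rank_eq _ hzx'.1 hzx'.2
  have eq₁ := hG.eq_of_subset_of_rank_le hfxy (isSubspace_span _)
    (span_subset hfxy.1 (Set.union_subset hgz₁ hgx₁)) (by omega)
  have eq₂ := hG.eq_of_subset_of_rank_le hfzx (isSubspace_span _)
    (span_subset hfzx.1 (Set.union_subset hgz₂ hgx₂)) (by omega)
  refine (hf.rank_insert_inter_and_join hG (A := insert x B) (by omega) (x := y) (y := z)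
    (by simp [hxy.symm, hyB]) (by simp [hxz.symm, hzB]) hyz ?_).1 (eq₁.symm.trans eq₂)
  convert hs using 1
  ext
  simp
  tauto

/-- Each descent lowers both s and the rank by one, so t is invariant; at s = 1 it is the rank of
the center N of the star of the empty set. On the way back, f X is spanned by the centers of any two
stars through X. -/
theorem exists_frame (hG : G.IsPolarSpaceOfRank n) (t : ℕ) (hs : 1 ≤ s)
    (hsl : s + 2 ≤ l) (hf : G.IsTopFamily s (s + t) f) (hst : PreservesStars s f) :
    ∃ (N : Set P) (Q : Fin l × Bool → Set P), G.IsSingularSubspace N ∧ G.rank N = t ∧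
      (∀ x, G.IsSingularSubspace (Q x) ∧ G.rank (Q x) = t + 1 ∧ N ⊆ Q x) ∧
      (∀ x y, x ≠ y → y ≠ (x.1, !x.2) → G.Perp (Q x) (Q y)) ∧
      ∀ X, IsSingularSubset X → X.card = s → f X = G.span (⋃ x ∈ X, Q x) := by
  induction s, hs using Nat.le_induction generalizing f with
  | base =>
    have hsing : ∀ x : Fin l × Bool, IsSingularSubset {x} := fun x => by
      simpa using isSingularSubset_empty.insert (x := x) (by simp)
    obtain ⟨N, hN, hNr, hNf, -⟩ := hf.exists_center hst hG isSingularSubset_empty (by simp)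
      (by simpa using hsl)
    refine ⟨N, fun x => f {x}, hN, by omega, fun x => ⟨hf.isSingularSubspace _ (hsing x) (by simp),
      ?_, ?_⟩, fun x y hxy hxy' => ?_, fun X hX hX1 => ?_⟩
    · rw [hf.rank_eq _ (hsing x) (by simp), add_comm]
    · simpa using hNf x (by simp) (by simpa using hsing x)
    · have := (hf.rank_insert_inter_and_join hG (A := ∅) (by simp) (x := y) (y := x) (by simp)
        (by simp) hxy.symm ?_).2.1
      · simpa using this.symm
      · exact (hsing x).insert (X := {x}) (by
          simp only [Finset.mem_singleton]
          rintro rfl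
          exact hxy' (by simp))
    · obtain ⟨x, rfl⟩ := Finset.card_eq_one.1 hX1
      simp [(hf.isSingularSubspace _ hX hX1).1.span_eq]
  | succ s hs ih =>
    rw [show s + 1 + t = s + t + 1 by omega] at hf
    obtain ⟨g, hg, hgst, hgf⟩ := hf.descend hst hG (by omega)
    obtain ⟨N, Q, hN, hNr, hQ, hQp, hgQ⟩ := ih (by omega) hg hgst
    refine ⟨N, Q, hN, hNr, hQ, hQp, fun X hX hXs => ?_⟩
    have hfX := hf.isSingularSubspace X hX hXs
    have hgX : ∀ a ∈ X, g (X.erase a) = G.span (⋃ x ∈ X.erase a, Q x) := fun a ha =>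
      hgQ _ (hX.mono (Finset.erase_subset _ _)) (by rw [Finset.card_erase_of_mem ha, hXs]; simp)
    obtain ⟨a, ha, b, hb, hab⟩ := Finset.one_lt_card.1 (show 1 < X.card by omega)
    have hj := (hg.rank_inter_and_join hG hX hXs ha hb hab).2.2.2
    have hga := hgf X hX hXs a ha
    have hgb := hgf X hX hXs b hb
    rw [← hG.eq_of_subset_of_rank_le hfX (isSubspace_span _)
      (span_subset hfX.1 (Set.union_subset hga hgb)) (by rw [hf.rank_eq X hX hXs, hj])]
    have hsub : ∀ c ∈ X, g (X.erase c) ⊆ G.span (⋃ x ∈ X, Q x) := fun c hc => by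
      rw [hgX c hc]
      exact span_mono (Set.biUnion_subset_biUnion_left (Finset.erase_subset _ _))
    have hQg : ∀ c ∈ X, ∀ x ∈ X, x ≠ c → Q x ⊆ g (X.erase c) := fun c hc x hx hxc => by
      rw [hgX c hc]
      exact (Set.subset_biUnion_of_mem (u := Q)
        (show x ∈ (X.erase c : Finset _) from Finset.mem_erase.2 ⟨hxc, hx⟩)).trans (subset_span _)
    apply (span_subset (isSubspace_span _) (Set.union_subset (hsub a ha) (hsub b hb))).antisymm
    refine span_subset (isSubspace_span _) (Set.iUnion₂_subset fun x hx => ?_)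
    refine subset_trans ?_ (subset_span _)
    rcases eq_or_ne x a with rfl | hxa
    · exact (hQg b hb x hx hab).trans Set.subset_union_right
    · exact (hQg a ha x hx hxa).trans Set.subset_union_left

end IsTopFamily

/-! ### Embeddings of polar Johnson graphs: images of stars and tops -/

/-- A clique cannot mix the two types. If W is outside the join of X and Y, it meets that join
exactly in X ∩ Y; if Z does not contain X ∩ Y, it lies in the join. Then Z ∩ W is inside X ∩ Y and
of equal rank, which forces X ∩ Y ⊆ Z after all. -/
theorem IsPolarSpaceOfRank.subset_join_or_inter_subset {n r : ℕ}
    (hG : G.IsPolarSpaceOfRank n) {X Y Z W : Set P} (hX : G.IsSingularSubspace X)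
    (hY : G.IsSingularSubspace Y) (hZ : G.IsSingularSubspace Z) (hW : G.IsSingularSubspace W)
    (hXYp : G.Perp X Y)
    (hXY : G.rank (X ∩ Y) + 1 = r) (hZX : G.rank (Z ∩ X) + 1 = r) (hZY : G.rank (Z ∩ Y) + 1 = r)
    (hWX : G.rank (W ∩ X) + 1 = r) (hWY : G.rank (W ∩ Y) + 1 = r) (hZW : G.rank (Z ∩ W) + 1 = r)
    (hZr : G.rank Z = r) (hWr : G.rank W = r) : W ⊆ G.span (X ∪ Y) ∨ X ∩ Y ⊆ Z := by
  by_contra! H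
  obtain ⟨hWU, hZ'⟩ := H
  have hU := hG.1.isSingularSubspace_join hX hY hXYp
  have hZU := hG.subset_join_of_not_inter_subset hX hY hZ hXY hZX hZY hZr hZ'
  have hXYW : X ∩ Y ⊆ W := by
    by_contra hnot
    exact hWU (hG.subset_join_of_not_inter_subset hX hY hW hXY hWX hWY hWr hnot)
  have hWUr : G.rank (W ∩ G.span (X ∪ Y)) < G.rank W :=
    hG.rank_lt hW (hW.1.inter hU.1) Set.inter_subset_left fun heq => hWU (Set.inter_eq_left.1 heq)
  have h₁ := hG.eq_of_subset_of_rank_le (hW.inter hU.1) (hX.1.inter hY.1)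
    (Set.subset_inter hXYW (Set.inter_subset_left.trans
      (Set.subset_union_left.trans (subset_span _)))) (by omega)
  have h₂ := hG.eq_of_subset_of_rank_le (hX.inter hY.1) (hZ.1.inter hW.1)
    (by rw [h₁]; exact fun x hx => ⟨hx.2, hZU hx.1⟩) (by omega)
  exact hZ' (h₂ ▸ Set.inter_subset_left)

/-- A map of the vertices of `PJ(l, m)` to `G.Grassmannian k` that preserves and reflects
adjacency and maps cliques to independent sets. -/
structure IsPolarJohnsonEmbedding (G : PointLineGeometry P) {l : ℕ} (m k : ℕ)
    (f : Finset (Fin l × Bool) → G.Grassmannian (k : ℤ)) : Prop where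
  adj : ∀ X Y, IsSingularSubset X → X.card = m + 1 → IsSingularSubset Y → Y.card = m + 1 →
    (X ∩ Y).card = m → IsSingularSubset (X ∪ Y) →
    G.rank ((f X).1 ∩ (f Y).1) + 1 = k + 1 ∧ G.Perp (f X).1 (f Y).1
  of_adj : ∀ X Y, IsSingularSubset X → X.card = m + 1 → IsSingularSubset Y → Y.card = m + 1 →
    G.rank ((f X).1 ∩ (f Y).1) + 1 = k + 1 → G.Perp (f X).1 (f Y).1 →
    (X ∩ Y).card = m ∧ IsSingularSubset (X ∪ Y)
  injective : ∀ X Y, IsSingularSubset X → X.card = m + 1 → IsSingularSubset Y →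
    Y.card = m + 1 → f X = f Y → X = Y
  indep : ∀ D : Finset (Finset (Fin l × Bool)),
    (∀ X ∈ D, IsSingularSubset X ∧ X.card = m + 1) →
    (∀ X ∈ D, ∀ Y ∈ D, X ≠ Y → (X ∩ Y).card = m ∧ IsSingularSubset (X ∪ Y)) →
    (G.grassmannSpace k).Independent (f '' D)

namespace IsPolarJohnsonEmbedding

variable {n l m k : ℕ} {f : Finset (Fin l × Bool) → G.Grassmannian (k : ℤ)}
  (hf : G.IsPolarJohnsonEmbedding m k f) (hG : G.IsPolarSpaceOfRank n)
include hf

theorem adj_insert {A : Finset (Fin l × Bool)} (hA : A.card = m) {x y : Fin l × Bool}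
    (hx : x ∉ A) (hy : y ∉ A) (hxy : x ≠ y) (hs : IsSingularSubset (insert x (insert y A))) :
    G.rank ((f (insert x A)).1 ∩ (f (insert y A)).1) + 1 = k + 1 ∧
      G.Perp (f (insert x A)).1 (f (insert y A)).1 := by
  have hint : insert x A ∩ insert y A = A := by
    ext t
    simp only [Finset.mem_inter, Finset.mem_insert]
    constructor
    · rintro ⟨rfl | h, rfl | h'⟩ <;> first | assumption | exact absurd rfl hxy
    · tauto
  refine hf.adj _ _ (hs.mono ?_) (by rw [Finset.card_insert_of_notMem hx, hA])
    (hs.mono (Finset.subset_insert _ _)) (by rw [Finset.card_insert_of_notMem hy, hA])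
    (by rw [hint, hA]) (hs.mono ?_)
  · exact Finset.insert_subset_insert _ (Finset.subset_insert _ _)
  · intro t
    simp only [Finset.mem_union, Finset.mem_insert]
    tauto

omit hf in
theorem card_inter_erase {Y : Finset (Fin l × Bool)} (hYc : Y.card = m + 2) {x y : Fin l × Bool}
    (hx : x ∈ Y) (hy : y ∈ Y) (hxy : x ≠ y) : (Y.erase x ∩ Y.erase y).card = m := by
  have : Y.erase x ∩ Y.erase y = (Y.erase x).erase y := by
    ext t
    simp only [Finset.mem_inter, Finset.mem_erase]
    tauto
  rw [this, Finset.card_erase_of_mem (Finset.mem_erase.2 ⟨hxy.symm, hy⟩),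
    Finset.card_erase_of_mem hx, hYc]
  rfl

omit hf in
theorem card_erase {Y : Finset (Fin l × Bool)} (hYc : Y.card = m + 2) {x : Fin l × Bool}
    (hx : x ∈ Y) : (Y.erase x).card = m + 1 := by
  rw [Finset.card_erase_of_mem hx, hYc]
  rfl

theorem adj_erase {Y : Finset (Fin l × Bool)} (hY : IsSingularSubset Y) (hYc : Y.card = m + 2)
    {x y : Fin l × Bool} (hx : x ∈ Y) (hy : y ∈ Y) (hxy : x ≠ y) :
    G.rank ((f (Y.erase x)).1 ∩ (f (Y.erase y)).1) + 1 = k + 1 ∧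
      G.Perp (f (Y.erase x)).1 (f (Y.erase y)).1 :=
  hf.adj _ _ (hY.mono (Y.erase_subset x)) (card_erase hYc hx) (hY.mono (Y.erase_subset y))
    (card_erase hYc hy) (card_inter_erase hYc hx hy hxy)
    (hY.mono (Finset.union_subset (Y.erase_subset x) (Y.erase_subset y)))

theorem indep_top {Y : Finset (Fin l × Bool)} (hY : IsSingularSubset Y) (hYc : Y.card = m + 2) :
    (G.grassmannSpace k).Independent (f '' (Y.image Y.erase : Finset _)) := by
  apply hf.indep
  · intro X hX
    obtain ⟨x, hx, rfl⟩ := Finset.mem_image.1 hX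
    exact ⟨hY.mono (Y.erase_subset x), card_erase hYc hx⟩
  · intro X hX X' hX' hne
    obtain ⟨x, hx, rfl⟩ := Finset.mem_image.1 hX
    obtain ⟨y, hy, rfl⟩ := Finset.mem_image.1 hX'
    exact ⟨card_inter_erase hYc hx hy (fun h => hne (h ▸ rfl)),
      hY.mono (Finset.union_subset (Y.erase_subset x) (Y.erase_subset y))⟩

theorem erase_injOn {Y : Finset (Fin l × Bool)} (hY : IsSingularSubset Y)
    (hYc : Y.card = m + 2) : Set.InjOn (fun y => f (Y.erase y)) Y := fun x hx y hy hxy =>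
  Y.erase_injOn hx hy (hf.injective _ _ (hY.mono (Y.erase_subset x)) (card_erase hYc hx)
    (hY.mono (Y.erase_subset y)) (card_erase hYc hy) hxy)

include hG

/-- Three elements of a star are not mapped to a line. -/
theorem not_inter_subset_of_subset_join {A : Finset (Fin l × Bool)} (hA : A.card = m)
    {x y z : Fin l × Bool} (hx : x ∉ A) (hy : y ∉ A) (hz : z ∉ A) (hxy : x ≠ y) (hxz : x ≠ z)
    (hyz : y ≠ z) (hs : IsSingularSubset (insert x (insert y (insert z A))))
    (hj : (f (insert z A)).1 ⊆ G.span ((f (insert x A)).1 ∪ (f (insert y A)).1)) :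
    ¬ (f (insert x A)).1 ∩ (f (insert y A)).1 ⊆ (f (insert z A)).1 := by
  intro hi
  have hsub : ∀ u, u = x ∨ u = y ∨ u = z → insert u A ⊆ insert x (insert y (insert z A)) := by
    intro u hu t
    simp only [Finset.mem_insert]
    rintro (rfl | h) <;> tauto
  have hsing : ∀ u, u = x ∨ u = y ∨ u = z →
      IsSingularSubset (insert u A) ∧ (insert u A).card = m + 1 := by
    intro u hu
    refine ⟨hs.mono (hsub u hu), ?_⟩
    rw [Finset.card_insert_of_notMem (by rcases hu with rfl | rfl | rfl <;> assumption), hA]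
  have hne : ∀ u v, u ∉ A → u ≠ v → insert u A ≠ insert v A := fun u v hu huv heq => by
    have : u ∈ insert v A := heq ▸ Finset.mem_insert_self u A
    simp [huv, hu] at this
  have hind := hf.indep {insert x A, insert y A, insert z A} (by
    simp only [Finset.mem_insert, Finset.mem_singleton]
    rintro X (rfl | rfl | rfl)
    exacts [hsing x (by simp), hsing y (by simp), hsing z (by simp)]) (by
    have key : ∀ u v, (u = x ∨ u = y ∨ u = z) → (v = x ∨ v = y ∨ v = z) →
        insert u A ≠ insert v A → (insert u A ∩ insert v A).card = m ∧
          IsSingularSubset (insert u A ∪ insert v A) := by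
      intro u v hu hv huv
      refine ⟨?_, hs.mono (Finset.union_subset (hsub u hu) (hsub v hv))⟩
      have hu' : u ∉ A := by rcases hu with rfl | rfl | rfl <;> assumption
      have : insert u A ∩ insert v A = A := by
        ext t
        simp only [Finset.mem_inter, Finset.mem_insert]
        constructor
        · rintro ⟨rfl | h, rfl | h'⟩ <;> first | assumption | exact absurd rfl huv
        · tauto
      rw [this, hA]
    simp only [Finset.mem_insert, Finset.mem_singleton]
    rintro X (rfl | rfl | rfl) Y (rfl | rfl | rfl) h <;> exact key _ _ (by simp) (by simp) h)
  have hadj := hf.adj_insert hA hx hy hxy (hs.mono (Finset.insert_subset_insert _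
    (Finset.insert_subset_insert _ (Finset.subset_insert _ _))))
  have hU := hG.1.isSingularSubspace_join (f (insert x A)).2.1 (f (insert y A)).2.1 hadj.2
  have hUr := hG.rank_join_add_rank_inter (f (insert x A)).2.1 (f (insert y A)).2.1 hadj.2
  rw [hG.rank_grassmannian, hG.rank_grassmannian] at hUr
  have fne : ∀ u v, (u = x ∨ u = y ∨ u = z) → (v = x ∨ v = y ∨ v = z) → u ∉ A → u ≠ v →
      f (insert u A) ≠ f (insert v A) := fun u v hu hv huA huv heq =>
    hne u v huA huv (hf.injective _ _ (hsing u hu).1 (hsing u hu).2 (hsing v hv).1 (hsing v hv).2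
      heq)
  refine hind.notMem_span (p := f (insert z A)) ⟨_, by simp, rfl⟩ (hG.mem_span_of_line
    (Y₁ := f (insert x A)) (Y₂ := f (insert y A)) (subset_span _ ⟨⟨_, by simp, rfl⟩, ?_⟩)
    (subset_span _ ⟨⟨_, by simp, rfl⟩, ?_⟩) ?_
    ((f (insert x A)).2.1.1.inter (f (insert y A)).2.1.1) (by omega) hU (by omega)
    Set.inter_subset_left Set.inter_subset_right hi
    (Set.subset_union_left.trans (subset_span _)) (Set.subset_union_right.trans (subset_span _)) hj)
  · exact fne x z (by simp) (by simp) hx hxz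
  · exact fne y z (by simp) (by simp) hy hyz
  · exact fne x y (by simp) (by simp) hx hxy

/-- A top that does not come from a top is contained in a big star. -/
theorem inter_subset_of_not_subset_join {Y : Finset (Fin l × Bool)} (hY : IsSingularSubset Y)
    (hYc : Y.card = m + 2) {x y z : Fin l × Bool} (hx : x ∈ Y) (hy : y ∈ Y) (hz : z ∈ Y)
    (hxy : x ≠ y)
    (hnot : ¬ (f (Y.erase z)).1 ⊆ G.span ((f (Y.erase x)).1 ∪ (f (Y.erase y)).1))
    {w : Fin l × Bool} (hw : w ∈ Y) :
    (f (Y.erase x)).1 ∩ (f (Y.erase y)).1 ⊆ (f (Y.erase w)).1 := by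
  rcases eq_or_ne w x with rfl | hwx
  · exact Set.inter_subset_left
  rcases eq_or_ne w y with rfl | hwy
  · exact Set.inter_subset_right
  have hzx : z ≠ x := by
    rintro rfl
    exact hnot (Set.subset_union_left.trans (subset_span _))
  have hzy : z ≠ y := by
    rintro rfl
    exact hnot (Set.subset_union_right.trans (subset_span _))
  have axy := hf.adj_erase hY hYc hx hy hxy
  have azx := (hf.adj_erase hY hYc hz hx hzx).1
  have azy := (hf.adj_erase hY hYc hz hy hzy).1
  have hr := fun X => hG.rank_grassmannian (f X)
  rcases eq_or_ne w z with rfl | hwz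
  · by_contra hnot'
    exact hnot (hG.subset_join_of_not_inter_subset (f _).2.1 (f _).2.1 (f _).2.1 axy.1 azx azy
      (hr _) hnot')
  · exact (hG.subset_join_or_inter_subset (f _).2.1 (f _).2.1 (f _).2.1 (f _).2.1 axy.2 axy.1
      (hf.adj_erase hY hYc hw hx hwx).1 (hf.adj_erase hY hYc hw hy hwy).1 azx azy
      (hf.adj_erase hY hYc hw hz hwz).1 (hr _) (hr _)).resolve_left hnot

/-- If every point common to the other members of a top were in f (Y \ {y}), then
`mem_span_of_inter_subset` would place f (Y \ {y}) in the span of the others, against independence.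
-/
theorem isTopFamily
    (htop : ∀ Y, IsSingularSubset Y → Y.card = m + 2 → ∀ x ∈ Y, ∀ y ∈ Y, ∀ z ∈ Y, x ≠ y →
      (f (Y.erase z)).1 ⊆ G.span ((f (Y.erase x)).1 ∪ (f (Y.erase y)).1)) :
    G.IsTopFamily (l := l) (m + 1) (k + 1) fun X => (f X).1 := by
  have hU : ∀ Y, IsSingularSubset Y → Y.card = m + 1 + 1 →
      ∃ U, G.IsSingularSubspace U ∧ G.rank U = k + 1 + 1 ∧ ∀ y ∈ Y, (f (Y.erase y)).1 ⊆ U := by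
    intro Y hY hYc
    obtain ⟨x, hx, y, hy, hxy⟩ := Finset.one_lt_card.1 (show 1 < Y.card by omega)
    have hadj := hf.adj_erase hY hYc hx hy hxy
    refine ⟨_, hG.1.isSingularSubspace_join (f _).2.1 (f _).2.1 hadj.2, ?_,
      fun z hz => htop Y hY hYc x hx y hy z hz hxy⟩
    have hUr := hG.rank_join_add_rank_inter (f (Y.erase x)).2.1 (f (Y.erase y)).2.1 hadj.2
    rw [hG.rank_grassmannian, hG.rank_grassmannian] at hUr
    omega
  refine ⟨fun X _ _ => (f X).2.1, fun X _ _ => hG.rank_grassmannian (f X), hU, ?_⟩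
  classical
  intro Y hY hYc y hy
  by_contra! H
  obtain ⟨U, hUs, hUr, hYU⟩ := hU Y hY hYc
  refine (hf.indep_top hY hYc).notMem_span (p := f (Y.erase y))
    ⟨_, Finset.mem_image_of_mem _ hy, rfl⟩ (span_mono ?_ (hG.mem_span_of_inter_subset hUs hUr
      ((Y.erase y).image fun y' => f (Y.erase y')) ?_ (f (Y.erase y)) (hYU y hy) ?_))
  · intro X hX
    obtain ⟨y', hy', rfl⟩ := Finset.mem_image.1 hX
    obtain ⟨hne, hy'⟩ := Finset.mem_erase.1 hy'
    exact ⟨⟨_, Finset.mem_image_of_mem _ hy', rfl⟩,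
      fun heq => hne (hf.erase_injOn hY hYc hy' hy heq)⟩
  · intro X hX
    obtain ⟨y', hy', rfl⟩ := Finset.mem_image.1 hX
    exact hYU y' (Finset.mem_of_mem_erase hy')
  · rintro p ⟨-, hp⟩
    by_contra hpy
    obtain ⟨y', hy', hne, hpy'⟩ := H p hpy
    refine hpy' (Set.mem_iInter₂.1 hp (f (Y.erase y')) ?_)
    exact Finset.mem_image_of_mem _ (Finset.mem_erase.2 ⟨hne, hy'⟩)

/-- If `m + 1` exceeds the dimension of the residues, all tops come from tops. -/
theorem subset_join_of_lt (hn : n < k + (m + 2)) {Y : Finset (Fin l × Bool)}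
    (hY : IsSingularSubset Y) (hYc : Y.card = m + 2) {x y z : Fin l × Bool} (hx : x ∈ Y)
    (hy : y ∈ Y) (hz : z ∈ Y) (hxy : x ≠ y) :
    (f (Y.erase z)).1 ⊆ G.span ((f (Y.erase x)).1 ∪ (f (Y.erase y)).1) := by
  classical
  by_contra hnot
  have hN : ∀ w ∈ Y, _ := fun w hw =>
    hf.inter_subset_of_not_subset_join hG hY hYc hx hy hz hxy hnot hw
  have hNs := (f (Y.erase x)).2.1.inter (f (Y.erase y)).2.1.1
  have hNr := (hf.adj_erase hY hYc hx hy hxy).1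
  have hC : ∀ X ∈ Y.image fun w => f (Y.erase w),
      (f (Y.erase x)).1 ∩ (f (Y.erase y)).1 ⊆ X.1 := by
    intro X hX
    obtain ⟨w, hw, rfl⟩ := Finset.mem_image.1 hX
    exact hN w hw
  have hCp : ∀ X ∈ Y.image fun w => f (Y.erase w), ∀ X' ∈ Y.image fun w => f (Y.erase w),
      G.Perp X.1 X'.1 := by
    intro X hX X' hX'
    obtain ⟨w, hw, rfl⟩ := Finset.mem_image.1 hX
    obtain ⟨v, hv, rfl⟩ := Finset.mem_image.1 hX'
    rcases eq_or_ne w v with rfl | hwv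
    · exact (f _).2.1.perp hG.1 subset_rfl subset_rfl
    · exact (hf.adj_erase hY hYc hw hv hwv).2
  -- The m + 2 members of the top would be independent over a center of rank k, hence span a
  -- singular subspace of rank k + m + 2, exceeding n.
  have := hG.rank_starJoin hNs (Nat.succ_injective hNr) _ hC hCp (by
    refine (hf.indep_top hY hYc).subset ?_
    intro X hX
    obtain ⟨w, hw, rfl⟩ := Finset.mem_image.1 hX
    exact ⟨_, Finset.mem_image_of_mem _ hw, rfl⟩)
  rw [Finset.card_image_of_injOn (hf.erase_injOn hY hYc), hYc] at this
  have := hG.rank_le (hG.isSingularSubspace_starJoin hNs hC hCp)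
  omega

theorem adj_of_subset {X Y : Finset (Fin l × Bool)} (hX : IsSingularSubset X)
    (hXc : X.card = m + 1) (hY : IsSingularSubset Y) (hYc : Y.card = m + 1) (hne : X ≠ Y)
    {U : Set P} (hU : G.IsSingularSubspace U) (hUr : G.rank U = k + 2) (hXU : (f X).1 ⊆ U)
    (hYU : (f Y).1 ⊆ U) : (X ∩ Y).card = m ∧ IsSingularSubset (X ∪ Y) :=
  hf.of_adj X Y hX hXc hY hYc (hG.rank_inter_of_hyperplanes hU (f X).2.1.1 (f Y).2.1.1 hXU hYU hUr
    (hG.rank_grassmannian _) (hG.rank_grassmannian _)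
    fun heq => hne (hf.injective X Y hX hXc hY hYc (Subtype.ext heq))).1
    (hU.perp hG.1 hXU hYU)

end IsPolarJohnsonEmbedding

namespace IsPolarJohnsonEmbedding

variable {n l m k : ℕ} {f : Finset (Fin l × Bool) → G.Grassmannian (k : ℤ)}
  (hf : G.IsPolarJohnsonEmbedding m k f) (hG : G.IsPolarSpaceOfRank n)
include hf hG

/-- Otherwise the images of A ∪ {x}, A ∪ {y}, A ∪ {z} lie in one U of rank k + 2. For a ∈ A, which
exists because m > 0, the top of A ∪ {x, y} also puts the image of (A ∪ {x, y}) \ {a} into U. It is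
thus adjacent to the image of A ∪ {z}, although the two index sets share at most m - 1 elements. -/
theorem preservesStars_of_tops (hm : 0 < m)
    (htop : ∀ Y, IsSingularSubset Y → Y.card = m + 2 → ∀ x ∈ Y, ∀ y ∈ Y, ∀ z ∈ Y, x ≠ y →
      (f (Y.erase z)).1 ⊆ G.span ((f (Y.erase x)).1 ∪ (f (Y.erase y)).1)) :
    PreservesStars (m + 1) fun X => (f X).1 := by
  intro A x y z hx hy hz hxy hxz hyz hA hs
  by_contra hnot
  have hA : A.card = m := by omega
  have hsxy : IsSingularSubset (insert x (insert y A)) := hs.mono (Finset.insert_subset_insert _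
    (Finset.insert_subset_insert _ (Finset.subset_insert _ _)))
  have hszy : IsSingularSubset (insert z (insert y A)) := by
    rw [Finset.insert_comm]
    exact hs.mono (Finset.subset_insert _ _)
  have hszx : IsSingularSubset (insert z (insert x A)) := by
    rw [Finset.insert_comm]
    exact hs.mono (Finset.insert_subset_insert _ (Finset.subset_insert _ _))
  have axy := hf.adj_insert hA hx hy hxy hsxy
  have hz' := hG.subset_join_of_not_inter_subset (f _).2.1 (f _).2.1 (f _).2.1 axy.1
    (hf.adj_insert hA hz hx hxz.symm hszx).1 (hf.adj_insert hA hz hy hyz.symm hszy).1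
    (hG.rank_grassmannian _) hnot
  have hU := hG.1.isSingularSubspace_join (f _).2.1 (f _).2.1 axy.2
  have hUr := hG.rank_join_add_rank_inter (f (insert x A)).2.1 (f (insert y A)).2.1 axy.2
  rw [hG.rank_grassmannian, hG.rank_grassmannian] at hUr
  obtain ⟨a, ha⟩ := Finset.card_pos.1 (hA ▸ hm)
  have hxA : x ∉ insert y A := by simp [hxy, hx]
  have hyA : y ∉ insert x A := by simp [hxy.symm, hy]
  have hc : (insert x (insert y A)).card = m + 2 := by
    rw [Finset.card_insert_of_notMem hxA, Finset.card_insert_of_notMem hy, hA]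
  have ha' := htop _ hsxy hc y (by simp) x (by simp) a (by simp [ha]) hxy.symm
  rw [Finset.erase_insert hxA, Finset.insert_comm, Finset.erase_insert hyA] at ha'
  have hsz : IsSingularSubset (insert z A) :=
    hszy.mono (Finset.insert_subset_insert _ (Finset.subset_insert _ _))
  have haY : a ∈ insert y (insert x A) := by simp [ha]
  rw [Finset.insert_comm] at hsxy hc
  have hcard := (hf.adj_of_subset hG (hsxy.mono (Finset.erase_subset a _)) (card_erase hc haY) hsz
    (by rw [Finset.card_insert_of_notMem hz, hA])
    (fun heq => by
      have : a ∈ insert z A := by simp [ha]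
      rw [← heq] at this
      simp at this) hU (by omega) ha' hz').1
  have hsub : (insert y (insert x A)).erase a ∩ insert z A ⊆ A.erase a := by
    intro t
    simp only [Finset.mem_inter, Finset.mem_erase, Finset.mem_insert]
    rintro ⟨⟨hta, ht⟩, rfl | htA⟩
    · rcases ht with h | h | h
      exacts [absurd h.symm hyz, absurd h.symm hxz, absurd h hz]
    · exact ⟨hta, htA⟩
  have := Finset.card_le_card hsub
  rw [Finset.card_erase_of_mem ha] at this
  omega

/-- Suppose x, y, z give a triple of top type with join U. A fourth compatible index w exists
because m + 3 < l, and its image is forced into U. By independence x, y, w are then not of star type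
either, which forces the image of A ∪ {-z} into U. So the images of A ∪ {z} and A ∪ {-z} would be
adjacent. -/
theorem preservesStars_of_le (hl : m + 4 ≤ l) : PreservesStars (m + 1) fun X => (f X).1 := by
  intro A x y z hx hy hz hxy hxz hyz hA hs
  by_contra hnot
  have hA : A.card = m := by omega
  rw [Finset.insert_comm y z, Finset.insert_comm x z] at hs
  have hsxy : IsSingularSubset (insert x (insert y A)) := hs.mono (Finset.subset_insert _ _)
  have axy := hf.adj_insert hA hx hy hxy hsxy
  have hU := hG.1.isSingularSubspace_join (f _).2.1 (f _).2.1 axy.2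
  have hUr := hG.rank_join_add_rank_inter (f (insert x A)).2.1 (f (insert y A)).2.1 axy.2
  rw [hG.rank_grassmannian, hG.rank_grassmannian] at hUr
  obtain ⟨w, hwA, hw⟩ := hs.exists_insert_isSingularSubset (by
    have h₁ := Finset.card_insert_le z (insert x (insert y A))
    have h₂ := Finset.card_insert_le x (insert y A)
    have h₃ := Finset.card_insert_le y A
    omega)
  simp only [Finset.mem_insert, not_or] at hwA
  obtain ⟨hwz, hwx, hwy, hwA⟩ := hwA
  have hwxy : IsSingularSubset (insert w (insert x (insert y A))) :=
    hw.mono (Finset.insert_subset_insert _ (Finset.subset_insert _ _))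
  have hwz' : IsSingularSubset (insert w (insert z A)) := hw.mono (by
    intro t
    simp only [Finset.mem_insert]
    tauto)
  have adj : ∀ u, u ∉ A → u ≠ x → u ≠ y → IsSingularSubset (insert u (insert x (insert y A))) →
      G.rank ((f (insert u A)).1 ∩ (f (insert x A)).1) + 1 = k + 1 ∧
      G.rank ((f (insert u A)).1 ∩ (f (insert y A)).1) + 1 = k + 1 := by
    intro u hu hux huy hsu
    refine ⟨(hf.adj_insert hA hu hx hux (hsu.mono ?_)).1, (hf.adj_insert hA hu hy huy
      (hsu.mono ?_)).1⟩
    · exact Finset.insert_subset_insert _ (Finset.insert_subset_insert _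
        (Finset.subset_insert _ _))
    · exact Finset.insert_subset_insert _ (Finset.subset_insert _ _)
  have az := adj z hz hxz.symm hyz.symm hs
  have aw := adj w hwA hwx hwy hwxy
  have hr := fun X => hG.rank_grassmannian (f X)
  have hzU := hG.subset_join_of_not_inter_subset (f _).2.1 (f _).2.1 (f _).2.1 axy.1 az.1 az.2
    (hr _) hnot
  have hwU := (hG.subset_join_or_inter_subset (f _).2.1 (f _).2.1 (f _).2.1 (f _).2.1 axy.2 axy.1
    az.1 az.2 aw.1 aw.2 (by
      rw [Set.inter_comm]
      exact (hf.adj_insert hA hwA hz hwz hwz').1) (hr _) (hr _)).resolve_right hnot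
  have hnot' := hf.not_inter_subset_of_subset_join hG hA hx hy hwA hxy (Ne.symm hwx)
    (Ne.symm hwy) (by rwa [Finset.insert_comm y w, Finset.insert_comm x w]) hwU
  set z' : Fin l × Bool := (z.1, !z.2) with hz'
  have hzz' : z ≠ z' := fun h => by simpa [hz'] using congrArg Prod.snd h
  have hzop : (z'.1, !z'.2) = z := by simp [hz']
  have hz'n := hs.notMem_of_insert
  simp only [← hz', Finset.mem_insert, not_or] at hz'n
  have hz'w : w ≠ z' := fun h => hw.notMem_of_insert (by simp [h, hz'])
  have hz's : IsSingularSubset (insert z' (insert w (insert x (insert y A)))) := hwxy.insert (by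
    rw [hzop]
    simp only [Finset.mem_insert, not_or]
    exact ⟨Ne.symm hwz, hxz.symm, hyz.symm, hz⟩)
  have az' := adj z' hz'n.2.2 hz'n.1 hz'n.2.1 (hz's.mono
    (Finset.insert_subset_insert _ (Finset.subset_insert _ _)))
  have hz'U := (hG.subset_join_or_inter_subset (f _).2.1 (f _).2.1 (f _).2.1 (f _).2.1 axy.2 axy.1
    aw.1 aw.2 az'.1 az'.2 (hf.adj_insert hA hwA hz'n.2.2 hz'w (by
      rw [Finset.insert_comm]
      refine hz's.mono ?_
      intro t
      simp only [Finset.mem_insert]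
      tauto)).1 (hr _) (hr _)).resolve_right hnot'
  have h := (hf.adj_of_subset hG (X := insert z A) (Y := insert z' A)
    (hs.mono (Finset.insert_subset_insert _ ?_))
    (by rw [Finset.card_insert_of_notMem hz, hA])
    (hz's.mono (Finset.insert_subset_insert _ ?_))
    (by rw [Finset.card_insert_of_notMem hz'n.2.2, hA]) ?_ hU (by omega) hzU hz'U).2
  · exact h z.1 z.2 (by simp) (by simp [hz'])
  · exact (Finset.subset_insert _ _).trans (Finset.subset_insert _ _)
  · intro t
    simp only [Finset.mem_insert]
    tauto
  · intro heq
    have : z ∈ insert z' A := heq ▸ Finset.mem_insert_self z A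
    simp [hzz', hz] at this

/-- If the stars come from stars and one top does not come from a top, then the image is contained
in a big star. -/
theorem exists_forall_subset (hst : PreservesStars (m + 1) fun X => (f X).1) (hl : m + 3 ≤ l)
    {Y : Finset (Fin l × Bool)} (hY : IsSingularSubset Y) (hYc : Y.card = m + 2)
    {x y z : Fin l × Bool} (hx : x ∈ Y) (hy : y ∈ Y) (hz : z ∈ Y) (hxy : x ≠ y)
    (hnot : ¬ (f (Y.erase z)).1 ⊆ G.span ((f (Y.erase x)).1 ∪ (f (Y.erase y)).1)) :
    ∃ S ∈ G.Grassmannian ((k : ℤ) - 1), ∀ X, IsSingularSubset X → X.card = m + 1 →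
      S ⊆ (f X).1 := by
  have hr := (hf.adj_erase hY hYc hx hy hxy).1
  refine ⟨(f (Y.erase x)).1 ∩ (f (Y.erase y)).1, hG.mem_grassmannian.2
    ⟨(f _).2.1.inter (f _).2.1.1, by omega⟩, fun X hX hXc => ?_⟩
  set N := (f (Y.erase x)).1 ∩ (f (Y.erase y)).1
  obtain ⟨t, htX, ht⟩ := hX.exists_insert_isSingularSubset (by omega)
  -- The property of a top that all its images contain N is carried from Y to a top through X by
  -- single exchanges.
  have := IsSingularSubset.induction_exchange (c := m + 2)
    (p := fun Y => ∀ w ∈ Y, N ⊆ (f (Y.erase w)).1) ?_ hY hYc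
    (fun w hw => hf.inter_subset_of_not_subset_join hG hY hYc hx hy hz hxy hnot hw) ht
    (by rw [Finset.card_insert_of_notMem htX, hXc]) t (by simp)
  · rwa [Finset.erase_insert htX] at this
  · intro Y hY hYc hN t ht s hs hs' w hw
    have hst' : s ∉ Y.erase t := fun h => hs (Finset.mem_of_mem_erase h)
    rcases Finset.mem_insert.1 hw with rfl | hw
    · rw [Finset.erase_insert hst']
      exact hN t ht
    obtain ⟨hwt, hwY⟩ := Finset.mem_erase.1 hw
    have hsw : s ≠ w := fun h => hs (h ▸ hwY)
    have hA₁ : insert w ((Y.erase t).erase w) = Y.erase t := Finset.insert_erase hw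
    have hA₂ : insert t ((Y.erase t).erase w) = Y.erase w := by
      rw [Finset.erase_right_comm, Finset.insert_erase (Finset.mem_erase.2 ⟨hwt.symm, ht⟩)]
    rw [Finset.erase_insert_of_ne hsw]
    have hAc : ((Y.erase t).erase w).card = m := by
      rw [Finset.card_erase_of_mem hw, card_erase hYc ht]
      rfl
    -- The star of Y \ {t, w} contains Y \ {t} and Y \ {w}, whose images contain N, so all its
    -- images do. Here s may be opposite to t, which is why the form with an unrestricted third
    -- index is needed.
    refine subset_trans ?_ (hst.inter_subset (x := w) (y := t) (by omega) (by omega) (by simp)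
      (by simp) (by simp [hs]) hwt ?_ (hs'.mono (Finset.insert_subset_insert _
        (Finset.erase_subset _ _))))
    · simp only [hA₁, hA₂]
      exact Set.subset_inter (hN t ht) (hN w hwY)
    · rwa [hA₂, Finset.insert_erase hwY]

end IsPolarJohnsonEmbedding

/-! ### The frame in the star space -/

theorem IsPolarSpaceOfRank.starSpace_collinear_iff {n t : ℕ} (hG : G.IsPolarSpaceOfRank n)
    {N : Set P} (hN : G.IsSingularSubspace N) (hNr : G.rank N = t) (ht : t + 2 ≤ n)
    {Q Q' : G.above N (t : ℤ)} :
    (G.starSpace N t).Collinear Q Q' ↔ G.Perp Q.1.1 Q'.1.1 := by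
  constructor
  · rintro ⟨ℓ, ⟨S, -, U, hU, -, hl⟩, hQ, hQ'⟩
    have hQ₁ : Q.1 ∈ G.between S U t := hl ▸ Set.mem_image_of_mem _ hQ
    have hQ₂ : Q'.1 ∈ G.between S U t := hl ▸ Set.mem_image_of_mem _ hQ'
    exact hU.1.perp hG.1 hQ₁.2 hQ₂.2
  · intro hp
    obtain ⟨U, hU, hUr, h₁, h₂⟩ : ∃ U, G.IsSingularSubspace U ∧ G.rank U = t + 2 ∧
        Q.1.1 ⊆ U ∧ Q'.1.1 ⊆ U := by
      have hr := hG.rank_grassmannian Q.1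
      have hr' := hG.rank_grassmannian Q'.1
      rcases eq_or_ne Q Q' with rfl | hne
      -- A point must be collinear with itself, so some U above Q is needed; it exists because Q has
      -- rank t + 1 < n.
      · obtain ⟨U, hU, hQU, hUr⟩ := hG.exists_superset_rank_succ Q.1.2.1 (by omega)
        exact ⟨U, hU, by omega, hQU, hQU⟩
      · refine ⟨_, hG.1.isSingularSubspace_join Q.1.2.1 Q'.1.2.1 hp, ?_,
          Set.subset_union_left.trans (subset_span _), Set.subset_union_right.trans (subset_span _)⟩
        have h₁ := hG.rank_join_add_rank_inter Q.1.2.1 Q'.1.2.1 hp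
        have h₂ := hG.rank_mono (Q.1.2.1.inter Q'.1.2.1.1) hN.1 (Set.subset_inter Q.2 Q'.2)
        have h₃ : G.rank (Q.1.1 ∩ Q'.1.1) < G.rank Q.1.1 := hG.rank_lt Q.1.2.1
          (Q.1.2.1.1.inter Q'.1.2.1.1) Set.inter_subset_left fun heq => hne <| Subtype.ext <|
            Subtype.ext <| hG.eq_of_subset_of_rank_le Q'.1.2.1 Q.1.2.1.1
              (Set.inter_eq_left.1 heq) (by omega)
        omega
    refine ⟨Subtype.val ⁻¹' G.between N U t, ⟨N, hG.mem_grassmannian.2 ⟨hN, by omega⟩, U,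
      hG.mem_grassmannian.2 ⟨hU, by omega⟩, (show N ⊆ Q.1.1 from Q.2).trans h₁, ?_⟩,
      ⟨Q.2, h₁⟩, ⟨Q'.2, h₂⟩⟩
    rw [Set.image_preimage_eq_iff, Subtype.range_coe]
    exact fun X hX => hX.1

/-- Points that are pairwise collinear except for opposite indices form a frame. -/
theorem isFrame_range {B : Type*} {H : PointLineGeometry B} {l : ℕ} {q : Fin l × Bool → B}
    (hq : ∀ x y, H.Collinear (q x) (q y) ↔ y ≠ (x.1, !x.2)) : H.IsFrame l (Set.range q) := by
  have hinj : Function.Injective q := by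
    intro x y hxy
    by_contra hne
    have h₁ := (hq y (x.1, !x.2)).2 fun h => hne (by
      have h₁ := congrArg Prod.fst h
      have h₂ := congrArg Prod.snd h
      simp at h₁ h₂
      exact Prod.ext h₁ h₂)
    rw [← hxy, hq] at h₁
    exact h₁ rfl
  refine ⟨?_, ?_⟩
  · rw [← Set.image_univ, hinj.injOn.encard_image, Set.encard_univ]
    simp [mul_comm]
  · rintro _ ⟨x, rfl⟩
    refine ⟨q (x.1, !x.2), ⟨⟨_, rfl⟩, fun h => (hq _ _).1 h rfl⟩, ?_⟩
    rintro _ ⟨⟨y, rfl⟩, hy⟩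
    rw [hq, not_not] at hy
    rw [hy]

theorem IsTopFamily.exists_isFrame {n l m k : ℕ}
    {f : Finset (Fin l × Bool) → G.Grassmannian (k : ℤ)}
    (ht : G.IsTopFamily (m + 1) (k + 1) fun X => (f X).1)
    (hst : PreservesStars (m + 1) fun X => (f X).1)
    (hf : G.IsPolarJohnsonEmbedding m k f) (hG : G.IsPolarSpaceOfRank n)
    (hl : m + 3 ≤ l) (hmk : m ≤ k) (hkn : k - m + 2 ≤ n) :
    ∃ N ∈ G.Grassmannian ((k : ℤ) - m - 1),
      (∀ X, IsSingularSubset X → X.card = m + 1 → N ⊆ (f X).1) ∧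
      ∃ ℬ : Set (G.above N ((k : ℤ) - m)),
        (G.starSpace N ((k : ℤ) - m)).IsFrame l ℬ ∧
        ∀ X, IsSingularSubset X → X.card = m + 1 →
          ∃ C ⊆ ℬ, (f X).1 = G.span (⋃ Q ∈ C, Q.1.1) := by
  obtain ⟨t, rfl⟩ := Nat.exists_eq_add_of_le hmk
  obtain ⟨N, Q, hN, hNr, hQ, hQp, hfQ⟩ := IsTopFamily.exists_frame hG t (by omega) (by omega)
    (show G.IsTopFamily (l := l) (m + 1) (m + 1 + t) fun X => (f X).1 by
      rwa [add_right_comm]) hst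
  have hcast : ((m + t : ℕ) : ℤ) - m = (t : ℤ) := by omega
  rw [hcast]
  -- Otherwise, for A of size m compatible with x, the images of A ∪ {x} and A ∪ {-x} would be
  -- perpendicular. They share the center of the star of A, hence would be adjacent, although the
  -- union of the index sets is not singular.
  have hopp : ∀ x, ¬ G.Perp (Q x) (Q (x.1, !x.2)) := by
    intro x hperp
    have hsx : IsSingularSubset ({x} : Finset (Fin l × Bool)) := by
      simpa using isSingularSubset_empty.insert (x := x) (by simp)
    obtain ⟨X, hxX, hX, hXc⟩ := hsx.exists_superset (c := m + 1) (by simp) (by omega)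
    have hxX := Finset.singleton_subset_iff.1 hxX
    set y : Fin l × Bool := (x.1, !x.2) with hy
    have hyX : y ∉ X := hX x.1 x.2 hxX
    have hxy : y ≠ x := fun h => hyX (h ▸ hxX)
    set A := X.erase x with hA
    have hyA : y ∉ A := fun h => hyX (Finset.mem_of_mem_erase h)
    have hxA : insert x A = X := Finset.insert_erase hxX
    have hAc : A.card = m := by
      rw [hA, Finset.card_erase_of_mem hxX, hXc]
      rfl
    have hAs : IsSingularSubset A := hX.mono (Finset.erase_subset _ _)
    have hY : IsSingularSubset (insert y A) := hAs.insert (by simp [hy, hA])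
    have hYc : (insert y A).card = m + 1 := by rw [Finset.card_insert_of_notMem hyA, hAc]
    have hp : G.Perp (f X).1 (f (insert y A)).1 := by
      rw [hfQ X hX hXc, hfQ _ hY hYc]
      refine hG.1.perp_span (Perp.symm (hG.1.perp_span ?_))
      intro q hq p hp
      obtain ⟨u, hu, hq⟩ := Set.mem_iUnion₂.1 hq
      obtain ⟨v, hv, hp⟩ := Set.mem_iUnion₂.1 hp
      rcases eq_or_ne u v with rfl | huv
      · exact (hQ u).1.collinear hG.1 hq hp
      by_cases hvu : v = (u.1, !u.2)
      · rcases Finset.mem_insert.1 hu with rfl | hu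
        · have hvx : v = x := by simp [hvu, hy]
          subst hvx
          exact (hperp p hp q hq).symm
        · exact absurd (hvu ▸ hv) (hX u.1 u.2 (Finset.mem_of_mem_erase hu))
      · exact hQp u v huv hvu q hq p hp
    obtain ⟨C, hC, hCr, hCf, -⟩ := ht.exists_center hst hG hAs (by omega) (by omega)
    have hCX : C ⊆ (f X).1 := by
      have := hCf x (by simp [hA]) (hxA.symm ▸ hX)
      rwa [hxA] at this
    have hCY : C ⊆ (f (insert y A)).1 := hCf y hyA hY
    have hne : X ≠ insert y A := fun h => hyX (h ▸ Finset.mem_insert_self y A)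
    have h₁ := hG.rank_mono ((f X).2.1.inter (f (insert y A)).2.1.1) hC.1
      (Set.subset_inter hCX hCY)
    have hr₁ := hG.rank_grassmannian (f X)
    have hr₂ := hG.rank_grassmannian (f (insert y A))
    have h₂ : G.rank ((f X).1 ∩ (f (insert y A)).1) < G.rank (f X).1 := hG.rank_lt (f X).2.1
      ((f X).2.1.1.inter (f (insert y A)).2.1.1) Set.inter_subset_left fun heq => hne <|
        hf.injective _ _ hX hXc hY hYc <| Subtype.ext <| hG.eq_of_subset_of_rank_le (f _).2.1
          (f X).2.1.1 (Set.inter_eq_left.1 heq) (by omega)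
    have h₃ := (hf.of_adj _ _ hX hXc hY hYc (by omega) hp).2
    exact h₃ x.1 x.2 (by simp [hxX]) (by simp [hy])
  let q : Fin l × Bool → G.above N (t : ℤ) := fun x =>
    ⟨⟨Q x, hG.mem_grassmannian.2 ⟨(hQ x).1, by have := (hQ x).2.1; omega⟩⟩, (hQ x).2.2⟩
  refine ⟨N, hG.mem_grassmannian.2 ⟨hN, by omega⟩, fun X hX hXc => ?_, Set.range q,
    isFrame_range fun x y => ?_, fun X hX hXc => ⟨q '' X, Set.image_subset_range _ _, ?_⟩⟩
  · obtain ⟨x, hx⟩ := Finset.card_pos.1 (show 0 < X.card by omega)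
    rw [hfQ X hX hXc]
    exact (hQ x).2.2.trans ((Set.subset_biUnion_of_mem (u := Q) hx).trans (subset_span _))
  · rw [hG.starSpace_collinear_iff hN hNr (by omega)]
    constructor
    · rintro h rfl
      exact hopp x h
    · intro hyx
      rcases eq_or_ne x y with rfl | hxy
      · exact (hQ x).1.perp hG.1 subset_rfl subset_rfl
      · exact hQp x y hxy hyx
  · rw [Set.biUnion_image]
    exact hfQ X hX hXc

/-! ### From the graph isomorphism to an embedding, and the theorem -/

theorem exists_isPolarJohnsonEmbedding {n k l m : ℕ} (hG : G.IsPolarSpaceOfRank n)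
    (hkn : k + 2 ≤ n) (hml : m + 2 ≤ l) (𝒳 : Set (G.Grassmannian k))
    (hiso : Nonempty ((G.grassmannGraph n k).induce 𝒳 ≃g polarJohnsonGraph l m))
    (hind : ∀ C : Set 𝒳, Maximal ((G.grassmannGraph n k).induce 𝒳).IsClique C →
      (G.grassmannSpace k).Independent (Subtype.val '' C)) :
    ∃ f : Finset (Fin l × Bool) → G.Grassmannian (k : ℤ), G.IsPolarJohnsonEmbedding m k f ∧
      ∀ Z ∈ 𝒳, ∃ X, IsSingularSubset X ∧ X.card = m + 1 ∧ f X = Z := by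
  classical
  obtain ⟨e⟩ := hiso
  obtain ⟨X₀, -, hX₀⟩ := (isSingularSubset_empty (l := l)).exists_superset (c := m + 1) (by simp)
    (by omega)
  -- Index sets that are not vertices get the image of an arbitrary vertex X₀; all properties
  -- concern vertices only.
  let φ : Finset (Fin l × Bool) → 𝒳 := fun X =>
    if h : IsSingularSubset X ∧ X.card = m + 1 then e.symm ⟨X, h⟩ else e.symm ⟨X₀, hX₀⟩
  have hφ : ∀ X (h : IsSingularSubset X ∧ X.card = m + 1), φ X = e.symm ⟨X, h⟩ :=
    fun X h => dif_pos h
  have hadj : ∀ X Y, IsSingularSubset X → X.card = m + 1 → IsSingularSubset Y →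
      Y.card = m + 1 → (((G.grassmannGraph n k).induce 𝒳).Adj (φ X) (φ Y) ↔
        (X ∩ Y).card = m ∧ IsSingularSubset (X ∪ Y)) := by
    intro X Y hX hXc hY hYc
    rw [hφ X ⟨hX, hXc⟩, hφ Y ⟨hY, hYc⟩, e.symm.map_adj_iff]
    exact and_congr_right fun _ => ⟨fun h => h hml, fun h _ => h⟩
  have hadj' : ∀ Z W : 𝒳, ((G.grassmannGraph n k).induce 𝒳).Adj Z W ↔
      G.rank (Z.1.1 ∩ W.1.1) + 1 = k + 1 ∧ G.Perp Z.1.1 W.1.1 := by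
    intro Z W
    change (G.HasDim (Z.1.1 ∩ W.1.1) ((k : ℤ) - 1) ∧ ((k : ℤ) ≤ (n : ℤ) - 2 → _)) ↔ _
    rw [hG.hasDim_iff (Z.1.2.1.inter W.1.2.1.1)]
    refine and_congr (by omega) ⟨fun h => h (by omega), fun h _ => h⟩
  have : Finite 𝒳 := Finite.of_equiv _ e.symm.toEquiv
  refine ⟨fun X => (φ X).1, ⟨?_, ?_, ?_, ?_⟩, ?_⟩
  · intro X Y hX hXc hY hYc h₁ h₂
    exact (hadj' _ _).1 ((hadj X Y hX hXc hY hYc).2 ⟨h₁, h₂⟩)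
  · intro X Y hX hXc hY hYc h₁ h₂
    exact (hadj X Y hX hXc hY hYc).1 ((hadj' _ _).2 ⟨h₁, h₂⟩)
  · intro X Y hX hXc hY hYc heq
    have := Subtype.val_injective heq
    rw [hφ X ⟨hX, hXc⟩, hφ Y ⟨hY, hYc⟩] at this
    exact congrArg Subtype.val (e.symm.injective this)
  · intro D hD hDp
    have hcl : ((G.grassmannGraph n k).induce 𝒳).IsClique (φ '' D) := by
      rintro _ ⟨X, hX, rfl⟩ _ ⟨Y, hY, rfl⟩ hne
      exact (hadj X Y (hD X hX).1 (hD X hX).2 (hD Y hY).1 (hD Y hY).2).2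
        (hDp X hX Y hY fun h => hne (h ▸ rfl))
    -- Independence is assumed only for maximal cliques; as 𝒳 is finite, every clique lies in one,
    -- and independence passes to subsets.
    obtain ⟨C, hDC, hC⟩ := (Set.toFinite {C | ((G.grassmannGraph n k).induce 𝒳).IsClique C}
      ).exists_le_maximal hcl
    refine (hind C hC).subset ?_
    rintro _ ⟨X, hX, rfl⟩
    exact ⟨φ X, hDC ⟨X, hX, rfl⟩, rfl⟩
  · intro Z hZ
    refine ⟨(e ⟨Z, hZ⟩).1, (e ⟨Z, hZ⟩).2.1, (e ⟨Z, hZ⟩).2.2, ?_⟩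
    change (φ _).1 = Z
    rw [hφ _ (e ⟨Z, hZ⟩).2, Subtype.coe_eta, RelIso.symm_apply_apply]

end PointLineGeometry

theorem theorem4p5 {P : Type*} (G : PointLineGeometry P) (n k l m : ℕ)
    (hG : G.IsPolarSpaceOfRank n)
    (hm : 0 < m) (hmk : m ≤ k) (hln : l ≤ n)
    (hlm : 3 ≤ (l : ℤ) - m) (hlmnk : (l : ℤ) - m ≤ (n : ℤ) - k)
    (𝒳 : Set (G.Grassmannian k))
    (hiso : Nonempty ((G.grassmannGraph n k).induce 𝒳 ≃g polarJohnsonGraph l m))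
    (hind : ∀ C : Set 𝒳, Maximal ((G.grassmannGraph n k).induce 𝒳).IsClique C →
      (G.grassmannSpace k).Independent (Subtype.val '' C))
    (hcase : (n : ℤ) - k < m + 2 ∨
      (4 ≤ (l : ℤ) - m ∧ ¬ ∃ S ∈ G.Grassmannian ((k : ℤ) - 1), 𝒳 ⊆ G.above S k)) :
    ∃ N ∈ G.Grassmannian ((k : ℤ) - m - 1),
      𝒳 ⊆ G.above N k ∧
      ∃ ℬ : Set (G.above N ((k : ℤ) - m)),
        (G.starSpace N ((k : ℤ) - m)).IsFrame l ℬ ∧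
        ∀ X ∈ 𝒳, ∃ C ⊆ ℬ, X.1 = G.span (⋃ Q ∈ C, Q.1.1) := by
  obtain ⟨f, hf, hX⟩ := PointLineGeometry.exists_isPolarJohnsonEmbedding hG (by omega) (by omega)
    𝒳 hiso hind
  obtain ⟨htop, hst⟩ : (∀ Y, IsSingularSubset Y → Y.card = m + 2 → ∀ x ∈ Y, ∀ y ∈ Y, ∀ z ∈ Y,
      x ≠ y → (f (Y.erase z)).1 ⊆ G.span ((f (Y.erase x)).1 ∪ (f (Y.erase y)).1)) ∧
      PointLineGeometry.PreservesStars (m + 1) fun X => (f X).1 := by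
    rcases hcase with hcase | ⟨hl, hbig⟩
    · have htop := fun Y hY hYc x hx y hy z hz hxy =>
        hf.subset_join_of_lt hG (by omega) (Y := Y) hY hYc (x := x) (y := y) (z := z) hx hy hz hxy
      exact ⟨htop, hf.preservesStars_of_tops hG hm htop⟩
    · have hst := hf.preservesStars_of_le hG (by omega)
      refine ⟨fun Y hY hYc x hx y hy z hz hxy => ?_, hst⟩
      -- A single top not sent to a top would put all of 𝒳 into one big star, which condition 2
      -- forbids.
      by_contra hnot
      obtain ⟨S, hS, hSX⟩ := hf.exists_forall_subset hG hst (by omega) hY hYc hx hy hz hxy hnot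
      refine hbig ⟨S, hS, fun Z hZ => ?_⟩
      obtain ⟨X, hX, hXc, rfl⟩ := hX Z hZ
      exact hSX X hX hXc
  obtain ⟨N, hN, hNX, ℬ, hB, hspan⟩ := (hf.isTopFamily hG htop).exists_isFrame hst hf hG
    (by omega) hmk (by omega)
  refine ⟨N, hN, fun Z hZ => ?_, ℬ, hB, fun Z hZ => ?_⟩
  · obtain ⟨X, hXs, hXc, rfl⟩ := hX Z hZ
    exact hNX X hXs hXc
  · obtain ⟨X, hXs, hXc, rfl⟩ := hX Z hZ
    exact hspan X hXs hXc
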